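/- Let $f:\mathbb{R}^d\to\mathbb{R}$ be twice differentiable (its gradient $\mathbf g=\nabla f$ is differentiable everywhere; the Hessian $\mathbf H=\nabla^2 f$ need not be continuous). $\|\cdot\|$ is the Euclidean norm on vectors and the spectral norm on matrices. Assume: * (moral smoothness) for every $\mathbf x_0\in\mathbb{R}^d$ there is a constant $0<L(\mathbf x_0)<\infty$ with $\|\mathbf H(\mathbf y)\mathbf g(\mathbf y)-\mathbf H(\mathbf x)\mathbf g(\mathbf x)\|\le L(\mathbf x_0)\|\mathbf y-\mathbf x\|$ for all $\mathbf y\in\mathbb{R}^d$ and all $\mathbf x$ with $\|\mathbf g(\mathbf x)\|\le\|\mathbf g(\mathbf x_0)\|$; * (pseudo-inverse regularity) $\gamma>0$ and $\|\mathbf H(\mathbf x)\mathbf p\|\ge\gamma\|\mathbf p\|$ for all $\mathbf x$ and all $\mathbf p\in\mathrm{Range}(\mathbf H(\mathbf x))$; * (gradient-Hessian null-space property) $0<\nu\le1$ and, for all $\mathbf x$, $\|\mathbf U_\perp^{\top}\mathbf g(\mathbf x)\|^2\le\frac{1-\nu}{\nu}\|\mathbf U^{\top}\mathbf g(\mathbf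 x)\|^2$, where the columns of $\mathbf U$ and $\mathbf U_\perp$ are orthonormal bases of $\mathrm{Range}(\mathbf H(\mathbf x))$ and of its orthogonal complement. Let $\varepsilon>0$, $C\ge1$, $0<\rho<1$, $0<\tau<1$, and let $\theta<1$ be the inexactness tolerance. Starting from $\mathbf x_0$, Newton-MR with inexact Hessian and inexact updates proceeds as follows for $k=0,1,2,\dots$ until $\|\mathbf g_k\|\le\tau$, where $\mathbf g_k=\mathbf g(\mathbf x_k)$ and $\mathbf H_k=\mathbf H(\mathbf x_k)$. A matrix $\tilde{\mathbf H}_k=\mathbf H_k+\mathbf E_k$ is given, with $\mathbf E_k$ symmetric, $\|\mathbf E_k\|\le\varepsilon$ and $\|\tilde{\mathbf H}_k^{\dagger}\|\le C/\varepsilon$ ($\dagger$ is the Moore-Penrose inverse). The direction $\mathbf p_k\in\mathrm{Range}(\tilde{\mathbf H}_k)$ is an iterate of MINRES-QLP that satisfies $\langle\mathbf p_k,\tilde{\mathbf H}_k\mathbf g_k\rangle\le-(1-\theta)\|\mathbf g_k\|^2$. That is, for some $1\le t\le\mathrm{rank}(\tilde{\mathbf H}_k)$, $\mathbf p_k$ is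 the vector of least norm among the minimisers of $\|\tilde{\mathbf H}_k\mathbf p+\mathbf g_k\|$ over $\mathbf p\in\mathcal K_t$. Here $\mathcal K_t$ is the Krylov subspace $\mathcal K_t(\tilde{\mathbf H}_k,\tilde{\mathbf H}_k\mathbf g_k)$ or, if $\mathbf g_k\in\mathrm{Range}(\tilde{\mathbf H}_k)$, possibly $\mathcal K_t(\tilde{\mathbf H}_k,\mathbf g_k)$, with $\mathcal K_t(\mathbf A,\mathbf b)=\mathrm{span}\{\mathbf b,\mathbf A\mathbf b,\dots,\mathbf A^{t-1}\mathbf b\}$. The step length $\alpha_k$ is the largest $\alpha\in[0,1]$ with $\|\mathbf g(\mathbf x_k+\alpha\mathbf p_k)\|^2\le\|\mathbf g_k\|^2+2\rho\alpha\langle\mathbf p_k,\tilde{\mathbf H}_k\mathbf g_k\rangle$, and $\mathbf x_{k+1}=\mathbf x_k+\alpha_k\mathbf p_k$. Suppose that one of the following holds, and let $\tilde\nu$ and $\tilde\gamma$ be as stated there: * (general perturbations) $\tfrac12<\nu\le1$ and $\varepsilon<\gamma(2\nu-1)/4$; or (gradients in the range of the Hessian) $\nu=1$ and $\varepsilon<\gamma\nu/2$.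 In both cases $$\tilde\nu=2\nu-1-\frac{4\varepsilon}{\gamma},\qquad \tilde\gamma=\Big(\frac1{\gamma-\varepsilon}+C\Big(\frac2\gamma+\frac{\sqrt{1-\nu}}{\varepsilon}\Big)\Big)^{-1};$$ * (acute perturbations) $\mathrm{rank}(\tilde{\mathbf H}_k)=\mathrm{rank}(\mathbf H_k)$ at every iteration that is carried out, $0<\nu\le1$ and $\varepsilon<\gamma\nu/2$. In this case $\tilde\nu=\nu-2\varepsilon/\gamma$ and $\tilde\gamma=\gamma-\varepsilon$. Suppose also that $1-\tilde\nu\le\theta<1$, and put $$\eta=\max\Big\{0,\ \frac{4\rho\tilde\gamma^2(1-\theta)}{L(\mathbf x_0)}\Big((1-\rho)(1-\theta)-\frac{\varepsilon}{\tilde\gamma}\Big)\Big\}.$$ Then $\eta\in[0,1]$ whenever $\mathbf g(\mathbf x_0)\ne\mathbf 0$, and for every iteration $k$ that is carried out $$\|\mathbf g_{k+1}\|^2\le(1-\eta)\,\|\mathbf g_k\|^2 .$$ -/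

import Mathlib

namespace NewtonMR

/-- The space `ℝ^d` with the Euclidean norm. -/
abbrev Vec (d : ℕ) : Type := EuclideanSpace ℝ (Fin d)

/-- `d × d` real matrices, seen as linear operators on `ℝ^d`; the norm is the spectral norm. -/
abbrev Op (d : ℕ) : Type := Vec d →L[ℝ] Vec d

/-- The range (column space) of a matrix. -/
def rangeOf {d : ℕ} (A : Op d) : Submodule ℝ (Vec d) := LinearMap.range A.toLinearMap

/-- The rank of a matrix. -/
noncomputable def rankOf {d : ℕ} (A : Op d) : ℕ := Module.finrank ℝ (rangeOf A)

/-- The Hessian of `f` at `x`: the (Fréchet) derivative of the gradient. -/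
noncomputable def hessian {d : ℕ} (f : Vec d → ℝ) (x : Vec d) : Op d :=
  fderiv ℝ (gradient f) x

/-! ### Assumptions on the objective -/

/-- `f` is differentiable and so is its gradient (the Hessian need not be continuous). -/
def TwiceDifferentiable {d : ℕ} (f : Vec d → ℝ) : Prop :=
  Differentiable ℝ f ∧ Differentiable ℝ (gradient f)

/-- Moral smoothness with constants `L x₀`: for every `x₀`, the map `x ↦ H(x) g(x)` satisfies a
Lipschitz estimate with constant `L x₀ > 0` between any point of
`{x | ‖g(x)‖ ≤ ‖g(x₀)‖}` and any point of `ℝ^d`. -/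
def MorallySmooth {d : ℕ} (f : Vec d → ℝ) (L : Vec d → ℝ) : Prop :=
  ∀ x₀ : Vec d, 0 < L x₀ ∧
    ∀ x y : Vec d, ‖gradient f x‖ ≤ ‖gradient f x₀‖ →
      ‖hessian f y (gradient f y) - hessian f x (gradient f x)‖ ≤ L x₀ * ‖y - x‖

/-- Pseudo-inverse regularity with constant `γ > 0`. -/
def PseudoInverseRegular {d : ℕ} (f : Vec d → ℝ) (γ : ℝ) : Prop :=
  0 < γ ∧ ∀ x : Vec d, ∀ p ∈ rangeOf (hessian f x), γ * ‖p‖ ≤ ‖hessian f x p‖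

/-- Gradient-Hessian null-space property with constant `0 < ν ≤ 1`. If the columns of `U` are an
orthonormal basis of a subspace then `‖Uᵀ g‖` is the norm of the orthogonal projection of `g` onto
that subspace. -/
def NullSpaceProperty {d : ℕ} (f : Vec d → ℝ) (ν : ℝ) : Prop :=
  0 < ν ∧ ν ≤ 1 ∧ ∀ x : Vec d,
    ‖(rangeOf (hessian f x))ᗮ.starProjection (gradient f x)‖ ^ 2 ≤
      (1 - ν) / ν * ‖(rangeOf (hessian f x)).starProjection (gradient f x)‖ ^ 2

/-! ### The perturbation of the Hessian -/

/-- `X` is the Moore-Penrose inverse of `A`: the four Penrose equations. -/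
def IsMoorePenroseInverse {d : ℕ} (A X : Op d) : Prop :=
  A ∘L X ∘L A = A ∧ X ∘L A ∘L X = X ∧ IsSelfAdjoint (A ∘L X) ∧ IsSelfAdjoint (X ∘L A)

/-- `At = A + E` with `E` symmetric, `‖E‖ ≤ ε`, and the Moore-Penrose inverse of `At` has spectral
norm at most `C / ε`. -/
def IsPerturbation {d : ℕ} (A At : Op d) (ε C : ℝ) : Prop :=
  (∃ E : Op d, IsSelfAdjoint E ∧ At = A + E ∧ ‖E‖ ≤ ε) ∧
    ∃ X : Op d, IsMoorePenroseInverse At X ∧ ‖X‖ ≤ C / ε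

/-- The perturbation regimes: general perturbations, and the two kinds of inherently stable ones
(rank-preserving perturbations, and gradients lying in the range of the Hessian, `ν = 1`). -/
inductive Regime : Type
  | general : Regime
  | acute : Regime
  | fullRange : Regime

/-- The conditions on `ε` and `ν` in each regime. -/
def Regime.Condition (R : Regime) (γ ν ε : ℝ) : Prop :=
  match R with
  | .general => 1 / 2 < ν ∧ ν ≤ 1 ∧ ε < γ * (2 * ν - 1) / 4
  | .acute => 0 < ν ∧ ν ≤ 1 ∧ ε < γ * ν / 2
  | .fullRange => ν = 1 ∧ ε < γ * ν / 2

/-- The constant `ν̃`; only for acute perturbations is the special formula available. -/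
noncomputable def Regime.nuTilde (R : Regime) (γ ν ε : ℝ) : ℝ :=
  match R with
  | .acute => ν - 2 * ε / γ
  | _ => 2 * ν - 1 - 4 * ε / γ

/-- The constant `γ̃`; only for acute perturbations is the special formula available. -/
noncomputable def Regime.gammaTilde (R : Regime) (γ ν ε C : ℝ) : ℝ :=
  match R with
  | .acute => γ - ε
  | _ => (1 / (γ - ε) + C * (2 / γ + Real.sqrt (1 - ν) / ε))⁻¹

/-! ### MINRES-QLP directions -/

/-- The Krylov subspace `K_t(A, b) = span {b, A b, …, A^(t-1) b}`. -/
def krylov {d : ℕ} (A : Op d) (b : Vec d) (t : ℕ) : Submodule ℝ (Vec d) :=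
  Submodule.span ℝ ((fun i : ℕ => (A ^ i) b) '' Set.Iio t)

/-- `K` is a range-invariant Krylov subspace of dimension parameter `t`: `K_t(A, A b)`, which may
always be used, or `K_t(A, b)`, which may be used if `b ∈ Range(A)`. -/
def IsRangeInvariantKrylov {d : ℕ} (A : Op d) (b : Vec d) (t : ℕ)
    (K : Submodule ℝ (Vec d)) : Prop :=
  K = krylov A (A b) t ∨ (b ∈ rangeOf A ∧ K = krylov A b t)

/-- The minimisers of `‖A p + g‖` over the subspace `K`. -/
def residualMinimizers {d : ℕ} (A : Op d) (g : Vec d) (K : Submodule ℝ (Vec d)) : Set (Vec d) :=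
  {p | p ∈ K ∧ ∀ q ∈ K, ‖A p + g‖ ≤ ‖A q + g‖}

/-- `p` is the `t`-th iterate of MINRES-QLP for `A p ≈ -g`: the element of least norm among the
minimisers of the residual over a range-invariant Krylov subspace. -/
def IsMinresQLPIterate {d : ℕ} (A : Op d) (g : Vec d) (t : ℕ) (p : Vec d) : Prop :=
  1 ≤ t ∧ t ≤ rankOf A ∧
    ∃ K : Submodule ℝ (Vec d), IsRangeInvariantKrylov A g t K ∧
      p ∈ residualMinimizers A g K ∧ ∀ q ∈ residualMinimizers A g K, ‖p‖ ≤ ‖q‖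

/-- `p` is an inexact update direction with tolerance `θ`: an iterate of MINRES-QLP that lies in
`Range(A)` and satisfies `⟨p, A g⟩ ≤ -(1 - θ) ‖g‖²`. -/
def IsInexactDirection {d : ℕ} (A : Op d) (g : Vec d) (θ : ℝ) (p : Vec d) : Prop :=
  (∃ t : ℕ, IsMinresQLPIterate A g t p) ∧ p ∈ rangeOf A ∧
    inner ℝ p (A g) ≤ -(1 - θ) * ‖g‖ ^ 2

/-! ### The algorithm -/

/-- The Armijo-type condition for the step length `a`. -/
def Armijo {d : ℕ} (f : Vec d → ℝ) (ρ : ℝ) (A : Op d) (x p : Vec d) (a : ℝ) : Prop :=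
  ‖gradient f (x + a • p)‖ ^ 2 ≤
    ‖gradient f x‖ ^ 2 + 2 * ρ * a * inner ℝ p (A (gradient f x))

/-- Iteration `k` is carried out: the stopping test `‖g‖ ≤ τ` has failed at the iterates
`x 0, …, x k`. -/
def Performed {d : ℕ} (f : Vec d → ℝ) (τ : ℝ) (x : ℕ → Vec d) (k : ℕ) : Prop :=
  ∀ j ≤ k, τ < ‖gradient f (x j)‖

/-- A run of Newton-MR with approximate Hessians `Ht k` and inexact updates: at each iteration that
is carried out, `p k` is an inexact direction, and the line search returns the largest step length
in `[0, 1]` that satisfies the Armijo-type condition. -/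
def IsInexactRun {d : ℕ} (f : Vec d → ℝ) (τ ρ θ : ℝ) (Ht : ℕ → Op d)
    (x p : ℕ → Vec d) (α : ℕ → ℝ) : Prop :=
  ∀ k : ℕ, Performed f τ x k →
    IsInexactDirection (Ht k) (gradient f (x k)) θ (p k) ∧
    IsGreatest {a : ℝ | 0 ≤ a ∧ a ≤ 1 ∧ Armijo f ρ (Ht k) (x k) (p k) a} (α k) ∧
    x (k + 1) = x k + α k • p k

/-- The contraction constant `η`; here `γt` stands for `γ̃` and `L₀` for `L(x₀)`. -/
noncomputable def eta (ρ θ ε γt L₀ : ℝ) : ℝ :=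
  max 0 (4 * ρ * γt ^ 2 * (1 - θ) / L₀ * ((1 - ρ) * (1 - θ) - ε / γt))

end NewtonMR

namespace NewtonMR

open Polynomial

/-! ### Real polynomials with value `1` at `0` -/

/-! Along `p` the squared gradient norm lies below a quadratic in the step length. Its slope at 0 is
2⟨p, Hg⟩, which differs from 2⟨p, H̃g⟩ by at most 2ε‖p‖‖g‖, and its leading coefficient is L(x₀)‖p‖²
(`norm_gradient_sq_le`). Given ‖p‖ ≤ ‖g‖/γ̃, the scalar lemma `line_search_contraction` produces η.
It needs 1 − θ ≤ L(x₀)/γ̃², which comes from γ²ν ≤ L(x₀) (`sq_mul_le_smoothness`).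

The main work is the bound on ‖p‖. The eigenvalues of H̃ have modulus at most ε or at least γ − ε
(`eigenvalue_dichotomy`), and the part of g in the small eigenspaces has norm at most (7ε/(6γ) +
√(1−ν))‖g‖ (`norm_starProjection_gradient_le`). If the rank is preserved, the small eigenvalues are
all zero (`norm_le_of_rank_eq`). Otherwise the nonzero ones have modulus at least ε/C, so the exact
solution −H̃†g obeys the bound. Passing to Krylov iterates (`norm_le_of_krylov`) uses the residual
polynomial r, with r(0) = 1.

Over K_t(H̃, g) the iterate is no longer than H̃†g (`sum_sq_krylov_le_sum_sq_div`). Over K_t(H̃,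
H̃g) one has r′(0) = 0 (`sum_sq_le_of_krylov_shifted`). A nonreal root of r forces p = −H̃†g.
Otherwise r = ∏(1 − uX) with ∑u = 0, eigenvalues being measured in units of ε. If all |u| ≤ 1, then
0 ≤ r ≤ 1 on [−1, 1], so on small eigenvalues p is dominated coordinatewise by H̃†g. If some |u| >
1, then |r| is large at i/√h, where h = ε/(γ−ε). A test polynomial obtained by division by X² + 1/h
then gives an orthogonality relation that controls the small eigenvalues up to a small error from
the large ones. -/

theorem exists_nonreal_root_or_eq_prod (r : ℝ[X]) (h0 : r.eval 0 = 1) :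
    (∃ z : ℂ, aeval z r = 0 ∧ z.im ≠ 0) ∨
      ∃ s : Multiset ℝ, r = (s.map fun u => 1 - C u * X).prod := by
  induction hn : r.natDegree using Nat.strong_induction_on generalizing r with
  | _ n ih =>
    by_cases hd : r.natDegree = 0
    · right
      refine ⟨0, ?_⟩
      rw [natDegree_eq_zero] at hd
      obtain ⟨c, rfl⟩ := hd
      simp at h0
      simp [h0]
    have hr0 : r ≠ 0 := by rintro rfl; simp at h0
    obtain ⟨z, hz⟩ : ∃ z : ℂ, aeval z r = 0 := by
      have hdeg : (r.map (algebraMap ℝ ℂ)).degree ≠ 0 := by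
        rw [degree_map]
        intro h
        exact hd (natDegree_eq_of_degree_eq_some h)
      obtain ⟨z, hz⟩ := IsAlgClosed.exists_root _ hdeg
      exact ⟨z, by rw [aeval_def, ← eval_map]; exact hz⟩
    by_cases hzi : z.im = 0
    swap
    · exact Or.inl ⟨z, hz, hzi⟩
    have hzr : z = algebraMap ℝ ℂ z.re := by
      apply Complex.ext <;> simp [hzi]
    have hroot : r.eval z.re = 0 := by
      rw [hzr, aeval_algebraMap_apply] at hz
      simpa using hz
    set x := z.re with hx
    have hx0 : x ≠ 0 := by
      intro h
      rw [h, h0] at hroot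
      exact one_ne_zero hroot
    -- The factor X − x is rescaled to 1 − x⁻¹X, so that the cofactor again has value 1 at 0 and the
    -- induction continues.
    obtain ⟨q, hq⟩ := dvd_iff_isRoot.2 hroot
    have hq' : r = (1 - C x⁻¹ * X) * (C (-x) * q) := by
      rw [hq]
      have : (C x⁻¹ : ℝ[X]) * C x = 1 := by rw [← C_mul, inv_mul_cancel₀ hx0, C_1]
      rw [C_neg]
      linear_combination (-X * q) * this
    have hr1 : (C (-x) * q).eval 0 = 1 := by
      rw [hq'] at h0
      simpa using h0
    have hlt : (C (-x) * q).natDegree < n := by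
      rw [natDegree_C_mul (neg_ne_zero.2 hx0)]
      have hq0 : q ≠ 0 := by rintro rfl; simp at hq; exact hr0 hq
      have : r.natDegree = 1 + q.natDegree := by
        rw [hq, natDegree_mul (X_sub_C_ne_zero _) hq0, natDegree_X_sub_C]
      omega
    rcases ih _ hlt _ hr1 rfl with ⟨w, hw, hwi⟩ | ⟨s, hs⟩
    · left
      exact ⟨w, by rw [hq', map_mul, hw, mul_zero], hwi⟩
    · right
      refine ⟨x⁻¹ ::ₘ s, ?_⟩
      rw [Multiset.map_cons, Multiset.prod_cons, ← hs]
      exact hq'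

theorem coeff_prod_one_sub (s : Multiset ℝ) :
    (s.map fun u => (1 - C u * X : ℝ[X])).prod.coeff 0 = 1 ∧
    (s.map fun u => (1 - C u * X : ℝ[X])).prod.coeff 1 = -s.sum ∧
    2 * (s.map fun u => (1 - C u * X : ℝ[X])).prod.coeff 2 =
      s.sum ^ 2 - (s.map fun u => u ^ 2).sum := by
  induction s using Multiset.induction_on with
  | empty => simp [coeff_one]
  | cons a s ih =>
    obtain ⟨h0, h1, h2⟩ := ih
    have e : ((a ::ₘ s).map fun u => (1 - C u * X : ℝ[X])).prod =
        (s.map fun u => (1 - C u * X : ℝ[X])).prod -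
          C a * ((s.map fun u => (1 - C u * X : ℝ[X])).prod * X) := by
      rw [Multiset.map_cons, Multiset.prod_cons]; ring
    rw [e]
    simp only [coeff_sub, coeff_C_mul, coeff_mul_X, coeff_mul_X_zero, Multiset.sum_cons,
      Multiset.map_cons, h0, h1]
    refine ⟨by ring, by ring, ?_⟩
    linear_combination h2

/-- Each factor 1 − ul lies between 0 and exp(−ul). When the u sum to zero, the product therefore
lies in [0, 1]. -/
theorem eval_prod_one_sub_mem_Icc (s : Multiset ℝ) (hs : ∀ u ∈ s, |u| ≤ 1) {l : ℝ} (hl : |l| ≤ 1) :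
    0 ≤ (s.map fun u => (1 - C u * X : ℝ[X])).prod.eval l ∧
    (s.map fun u => (1 - C u * X : ℝ[X])).prod.eval l ≤ Real.exp (-(s.sum * l)) := by
  induction s using Multiset.induction_on with
  | empty => simp
  | cons a s ih =>
    obtain ⟨h0, h1⟩ := ih fun u hu => hs u (Multiset.mem_cons_of_mem hu)
    have ha : |a * l| ≤ 1 := by
      rw [abs_mul]
      exact mul_le_one₀ (hs a (Multiset.mem_cons_self a s)) (abs_nonneg _) hl
    have hb : 0 ≤ 1 - a * l := by linarith [(abs_le.1 ha).2]
    have hc : 1 - a * l ≤ Real.exp (-(a * l)) := by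
      linarith [Real.add_one_le_exp (-(a * l))]
    rw [Multiset.map_cons, Multiset.prod_cons, eval_mul, Multiset.sum_cons]
    simp only [eval_sub, eval_one, eval_mul, eval_C, eval_X]
    refine ⟨mul_nonneg hb h0, ?_⟩
    rw [add_mul, neg_add, Real.exp_add]
    exact mul_le_mul hc h1 h0 (Real.exp_pos _).le

/-- On the imaginary axis a factor has squared modulus 1 + y²u², and the cross terms of the product
are nonnegative. -/
theorem one_add_sum_le_normSq_aeval (s : Multiset ℝ) (y : ℝ) :
    1 + y ^ 2 * (s.map fun u => u ^ 2).sum ≤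
      Complex.normSq (aeval (y * Complex.I) (s.map fun u => (1 - C u * X : ℝ[X])).prod) := by
  induction s using Multiset.induction_on with
  | empty => simp
  | cons a s ih =>
    rw [Multiset.map_cons, Multiset.sum_cons, Multiset.map_cons, Multiset.prod_cons, map_mul,
      Complex.normSq_mul]
    have e : Complex.normSq (aeval ((y : ℂ) * Complex.I) (1 - C a * X : ℝ[X])) =
        1 + y ^ 2 * a ^ 2 := by
      simp [Complex.normSq_apply]
      ring
    rw [e]
    have hS : 0 ≤ (s.map fun u => u ^ 2).sum :=
      Multiset.sum_nonneg (by simp only [Multiset.mem_map]; rintro _ ⟨u, -, rfl⟩; positivity)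
    have hp : 0 ≤ y ^ 2 * a ^ 2 := by positivity
    have hq : 0 ≤ y ^ 2 * (s.map fun u => u ^ 2).sum := by positivity
    nlinarith [mul_nonneg hp hq]

theorem sq_le_sum_sq_of_mem (s : Multiset ℝ) {u : ℝ} (hu : u ∈ s) :
    u ^ 2 ≤ (s.map fun u => u ^ 2).sum :=
  Multiset.single_le_sum (by simp only [Multiset.mem_map]; rintro _ ⟨u, -, rfl⟩; positivity) _
    (Multiset.mem_map_of_mem _ hu)

/-- The quadratic factor of a real polynomial at a nonreal root, with its positivity. -/
theorem exists_pos_quadratic_factor {r : ℝ[X]} {z : ℂ} (hz : aeval z r = 0) (hi : z.im ≠ 0)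
    (hr : r ≠ 0) :
    ∃ Q r₁ : ℝ[X], r = Q * r₁ ∧ (∀ l : ℝ, 0 < Q.eval l) ∧ r.natDegree = r₁.natDegree + 2 := by
  obtain ⟨r₁, h₁⟩ := quadratic_dvd_of_aeval_eq_zero_im_ne_zero r hz hi
  have hm : (X ^ 2 - C (2 * z.re) * X + C (‖z‖ ^ 2) : ℝ[X]).natDegree = 2 := by
    have : (X ^ 2 - C (2 * z.re) * X + C (‖z‖ ^ 2) : ℝ[X]) =
      C 1 * X ^ 2 + C (-(2 * z.re)) * X + C (‖z‖ ^ 2) := by simp; ring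
    rw [this]
    exact natDegree_quadratic one_ne_zero
  refine ⟨_, r₁, h₁, fun l => ?_, ?_⟩
  · have : ‖z‖ ^ 2 = z.re ^ 2 + z.im ^ 2 := by
      rw [← Complex.normSq_eq_norm_sq, Complex.normSq_apply]; ring
    simp only [eval_add, eval_sub, eval_pow, eval_X, eval_mul, eval_C, this]
    have : 0 < z.im ^ 2 := by positivity
    nlinarith [sq_nonneg (l - z.re)]
  · have hne : (X ^ 2 - C (2 * z.re) * X + C (‖z‖ ^ 2) : ℝ[X]) ≠ 0 := by
      intro h; rw [h, zero_mul] at h₁; exact hr h₁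
    have hne' : r₁ ≠ 0 := by
      intro h; rw [h, mul_zero] at h₁; exact hr h₁
    rw [h₁, natDegree_mul hne hne', hm, add_comm]

/-! ### Scalar estimates -/

/-- Write 1 − 1/R = t(1 + ik). Dividing the equation by R shows that e√h = k and c = t(1 + k²) solve
it; the bounds on e and c come from |1/R|² ≤ h/(1+h). -/
theorem exists_shift_of_normSq {h : ℝ} (hh : 0 < h) (R : ℂ) (hR : 1 + 1 / h ≤ Complex.normSq R) :
    ∃ e c : ℝ, |e| ≤ 1 ∧ (1 + |e|) * (1 - h) / 2 ≤ c ∧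
      (1 - ((e * Real.sqrt h : ℝ) : ℂ) * Complex.I) * (1 - R) + c * R = 0 := by
  set s := Real.sqrt h with hs
  have hs0 : 0 < s := Real.sqrt_pos.2 hh
  have hs2 : s ^ 2 = h := Real.sq_sqrt hh.le
  have hN : 0 < Complex.normSq R := lt_of_lt_of_le (by positivity) hR
  have hR0 : R ≠ 0 := Complex.normSq_pos.1 hN
  set x := (R⁻¹).re with hx
  set y := (R⁻¹).im with hy
  have hxy : (x ^ 2 + y ^ 2) * (1 + h) ≤ h := by
    have h1 : x ^ 2 + y ^ 2 = (Complex.normSq R)⁻¹ := by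
      rw [← Complex.normSq_inv, Complex.normSq_apply]; ring
    rw [h1, inv_mul_le_iff₀ hN]
    have : h * (1 + 1 / h) ≤ h * Complex.normSq R := mul_le_mul_of_nonneg_left hR hh.le
    have e : h * (1 + 1 / h) = 1 + h := by field_simp; ring
    linarith
  have hx1 : x < 1 := by
    by_contra hcon
    push Not at hcon
    have : 1 ≤ x ^ 2 + y ^ 2 := by nlinarith [sq_nonneg y]
    nlinarith
  set t := 1 - x with ht
  have ht0 : 0 < t := by linarith
  set k := -y / t with hk
  have hyk : y = -(k * t) := by rw [hk]; field_simp
  set c := t * (1 + k ^ 2) with hc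
  -- Since (1 + k²)|1/R|² = (1 − c)² + k², this is the bound on |1/R|² multiplied by 1 + k².
  have hcq : (1 - c) ^ 2 * (1 + h) ≤ h - k ^ 2 := by
    have hxt : x = 1 - t := by linarith
    rw [hxt, hyk] at hxy
    have : 0 ≤ (1 + k ^ 2) * (h - ((1 - t) ^ 2 + (-(k * t)) ^ 2) * (1 + h)) :=
      mul_nonneg (by positivity) (by linarith)
    rw [hc]
    nlinarith
  have hk2 : k ^ 2 ≤ h := by nlinarith [sq_nonneg (1 - c)]
  have hes : k / s * s = k := by field_simp
  have he1 : |k / s| ≤ 1 := by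
    rw [abs_div, abs_of_pos hs0, div_le_one hs0]
    exact abs_le_of_sq_le_sq (by rw [hs2]; exact hk2) hs0.le
  refine ⟨k / s, c, he1, ?_, ?_⟩
  · set e := |k / s| with he
    have he0 : 0 ≤ e := abs_nonneg _
    have hke : k ^ 2 = e ^ 2 * h := by rw [he, sq_abs, ← hs2, ← mul_pow, hes]
    -- AM-GM applied to the factors h(1+e) and 1−e of h(1 − e²).
    have h1 : (1 - c) ^ 2 ≤ ((h * (1 + e) + (1 - e)) / 2) ^ 2 := by
      have h3 : 0 ≤ (1 - c) ^ 2 * h := by positivity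
      have h4 : (1 - c) ^ 2 ≤ h * (1 - e ^ 2) := by rw [hke] at hcq; linarith
      nlinarith [sq_nonneg (h * (1 + e) - (1 - e))]
    have h2 := abs_le_of_sq_le_sq h1
      (by have : 0 ≤ h * (1 + e) := by positivity
          linarith)
    linarith [(abs_le.1 h2).2]
  · have e1 : (1 - ((k / s * s : ℝ) : ℂ) * Complex.I) * (R⁻¹ - 1) + c = 0 := by
      rw [hes]
      generalize R⁻¹ = W at hx hy
      apply Complex.ext
      · simp
        rw [← hx, ← hy]
        linear_combination hc + k * hyk - ht
      · simp
        rw [← hx, ← hy]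
        linear_combination hyk + k * ht
    have e2 : (1 - ((k / s * s : ℝ) : ℂ) * Complex.I) * (1 - R) + c * R =
        ((1 - ((k / s * s : ℝ) : ℂ) * Complex.I) * (R⁻¹ - 1) + c) * R := by
      field_simp
    rw [e2, e1, zero_mul]

/-- The discriminant condition for the quadratic in z of `shift_term_le_of_large`, with m in the
role of 1/(hl). -/
theorem shift_discriminant {h e m c : ℝ} (hh : 0 < h) (hh3 : h ≤ 1 / 3) (he : |e| ≤ 1)
    (hm : |m| ≤ 1) (hc : (1 + |e|) * (1 - h) / 2 ≤ c) :
    0 < h * (m ^ 2 - e * m) + c ∧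
    (1 + h) ^ 2 * (m ^ 2 - e * m) ^ 2 ≤ 4 * (h * m ^ 2 + 1) * (h * (m ^ 2 - e * m) + c) := by
  set E := |e| with hE
  set M := |m| with hM
  have hE0 : 0 ≤ E := abs_nonneg _
  have hM0 : 0 ≤ M := abs_nonneg _
  have hm2 : m ^ 2 = M ^ 2 := (sq_abs m).symm
  have hem : |e * m| = E * M := abs_mul e m
  obtain ⟨h1, h2⟩ := abs_le.1 hem.le
  set a := m ^ 2 - e * m with ha
  have hlo : M ^ 2 - E * M ≤ a := by rw [ha, hm2]; linarith
  have hhi : a ≤ M ^ 2 + E * M := by rw [ha, hm2]; linarith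
  have hlo' : -(1 / 4) ≤ a := by nlinarith [sq_nonneg (M - E / 2)]
  have hc3 : (1 + E) / 3 ≤ c := by nlinarith
  have hpos : 0 < h * a + c := by nlinarith
  refine ⟨hpos, ?_⟩
  rw [hm2]
  have hhM : 0 ≤ h * M ^ 2 := by positivity
  by_cases ha0 : a ≤ 0
  · have i1 : a ^ 2 ≤ 1 / 16 := by nlinarith
    have i2 : (1 + h) ^ 2 ≤ 16 / 9 := by nlinarith
    have i3 : (1 + h) ^ 2 * a ^ 2 ≤ 16 / 9 * (1 / 16) := by gcongr
    have i4 : 1 / 4 ≤ h * a + c := by nlinarith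
    have i5 : 4 * 1 * (1 / 4) ≤ 4 * (h * M ^ 2 + 1) * (h * a + c) := by gcongr; linarith
    linarith
  · push Not at ha0
    set n := M ^ 2 + E * M with hn
    have hn0 : 0 < n := lt_of_lt_of_le ha0 hhi
    have hn1 : n ≤ 1 + E := by nlinarith
    -- monotonicity of `m (m + e) / (h m² + 1)`
    have j1 : n * (1 + h) ≤ (1 + E) * (h * M ^ 2 + 1) := by
      have : (1 + E) * (h * M ^ 2 + 1) - n * (1 + h) = (1 - M) * ((1 + E) + M * (1 - h * E)) := by
        rw [hn]; ring
      have hhE : h * E ≤ 1 := by nlinarith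
      have : 0 ≤ (1 - M) * ((1 + E) + M * (1 - h * E)) :=
        mul_nonneg (by linarith) (by nlinarith [mul_nonneg hM0 (sub_nonneg.2 hhE)])
      linarith
    have j2 : (1 + h) * a ≤ 2 * (h * a + c) := by
      have : a * (1 - h) ≤ (1 + E) * (1 - h) := by gcongr <;> linarith
      nlinarith
    have j3 : a * (1 + h) ≤ 2 * (h * M ^ 2 + 1) := by
      have : a * (1 + h) ≤ n * (1 + h) := by gcongr
      have : (1 + E) * (h * M ^ 2 + 1) ≤ 2 * (h * M ^ 2 + 1) := by gcongr; linarith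
      linarith
    calc (1 + h) ^ 2 * a ^ 2 = (a * (1 + h)) * ((1 + h) * a) := by ring
      _ ≤ (2 * (h * M ^ 2 + 1)) * (2 * (h * a + c)) := by gcongr
      _ = _ := by ring

/-- In terms of m = 1/(hl), which lies in [−1, 1], the left side is a concave quadratic in z divided
by hm² + 1. The discriminant bounds its maximum. -/
theorem shift_term_le_of_large {h e c l z b : ℝ} (hh : 0 < h) (hh3 : h ≤ 1 / 3) (he : |e| ≤ 1)
    (hl : 1 ≤ h * |l|) (hc : (1 + |e|) * (1 - h) / 2 ≤ c) :
    ((1 - e * h * l) * (z * (b - z)) - c * h * l ^ 2 * z ^ 2) / (1 + h * l ^ 2) ≤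
      (h / (1 + h)) ^ 2 * b ^ 2 := by
  have hl0 : l ≠ 0 := by rintro rfl; simp at hl; linarith
  set m := 1 / (h * l) with hm
  have hm1 : |m| ≤ 1 := by
    rw [hm, abs_div, abs_one, abs_mul, abs_of_pos hh, div_le_one (by positivity)]
    exact hl
  obtain ⟨hp, hd⟩ := shift_discriminant hh hh3 he hm1 hc
  have hm0 : m ≠ 0 := by rw [hm]; positivity
  have hlm : l = 1 / (h * m) := by rw [hm]; field_simp
  set a := m ^ 2 - e * m with ha
  have key : h * a * z * b - (h * a + c) * z ^ 2 ≤
      (h / (1 + h)) ^ 2 * b ^ 2 * (h * m ^ 2 + 1) := by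
    have h2 : (h * a) ^ 2 ≤ 4 * (h * a + c) * ((h / (1 + h)) ^ 2 * (h * m ^ 2 + 1)) := by
      have : 4 * (h * a + c) * ((h / (1 + h)) ^ 2 * (h * m ^ 2 + 1)) =
        (h / (1 + h)) ^ 2 * (4 * (h * m ^ 2 + 1) * (h * a + c)) := by ring
      rw [this]
      calc (h * a) ^ 2 = (h / (1 + h)) ^ 2 * ((1 + h) ^ 2 * a ^ 2) := by field_simp
        _ ≤ _ := by gcongr
    have h3 : 0 ≤ (2 * (h * a + c) * z - h * a * b) ^ 2 := sq_nonneg _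
    have h4 := mul_le_mul_of_nonneg_right h2 (sq_nonneg b)
    have h5 : (h * a + c) * (h * a * z * b - (h * a + c) * z ^ 2) ≤
      (h * a + c) * ((h / (1 + h)) ^ 2 * b ^ 2 * (h * m ^ 2 + 1)) := by nlinarith
    exact le_of_mul_le_mul_left h5 hp
  have e1 : ((1 - e * h * l) * (z * (b - z)) - c * h * l ^ 2 * z ^ 2) / (1 + h * l ^ 2) =
      (h * a * z * b - (h * a + c) * z ^ 2) / (h * m ^ 2 + 1) := by
    rw [div_eq_div_iff (by positivity) (by positivity), hlm, ha]
    field_simp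
    ring
  rw [e1, div_le_iff₀ (by positivity)]
  exact key

theorem shift_weight_bounds {h e l : ℝ} (hh : 0 < h) (hh3 : h ≤ 1 / 3) (he : |e| ≤ 1)
    (hl : |l| ≤ 1) :
    0 ≤ (1 - e * h * l) / (1 + h * l ^ 2) ∧ (1 - e * h * l) / (1 + h * l ^ 2) ≤ 1 + h / 4 := by
  have h1 : |e * l| ≤ |l| := by
    rw [abs_mul]; exact mul_le_of_le_one_left (abs_nonneg _) he
  obtain ⟨h2, h3⟩ := abs_le.1 h1
  have h4 : l ^ 2 = |l| ^ 2 := (sq_abs l).symm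
  set m := |l| with hm
  have hm0 : 0 ≤ m := abs_nonneg _
  constructor
  · apply div_nonneg _ (by positivity)
    nlinarith
  · rw [div_le_iff₀ (by positivity), h4]
    have : 0 ≤ h * (m - 1 / 2) ^ 2 := by positivity
    have : 0 ≤ h * h * m ^ 2 := by positivity
    nlinarith

/-- The worst case is C|l| = 1 with e·l = |l|; the constant is the value of (1 + hm²)/((1 − hm)m²)
at m = 1/C. -/
theorem sq_le_shift_weight {h e l C p : ℝ} (hh : 0 < h) (hh3 : h ≤ 1 / 3) (he : |e| ≤ 1)
    (hC : 1 ≤ C) (hl : |l| ≤ 1) (hl' : 1 ≤ C * |l|) :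
    p ^ 2 ≤ C * (C ^ 2 + h) / (C - h) *
      ((1 - e * h * l) / (1 + h * l ^ 2) * (l * p) ^ 2) := by
  have h1 : |e * l| ≤ |l| := by
    rw [abs_mul]; exact mul_le_of_le_one_left (abs_nonneg _) he
  obtain ⟨h2, h3⟩ := abs_le.1 h1
  have h4 : l ^ 2 = |l| ^ 2 := (sq_abs l).symm
  rw [mul_pow, h4]
  set m := |l| with hm
  have hm0 : 0 < m := by
    rcases (abs_nonneg l).lt_or_eq with h | h
    · exact h
    · rw [hm, ← h] at hl'; linarith
  have hCh : 0 < C - h := by linarith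
  have h5 : (1 + h * m ^ 2) * (C - h) ≤ C * (C ^ 2 + h) * (1 - h * m) * m ^ 2 := by
    have hx : C * (C ^ 2 + h) * (1 - h * m) * m ^ 2 - (1 + h * m ^ 2) * (C - h) =
        (C * m - 1) * (C ^ 2 * m + C - h * (C ^ 2 * m ^ 2 + C * m + 1) - h ^ 2 * m ^ 2) := by ring
    have hy : 0 ≤ C ^ 2 * m + C - h * (C ^ 2 * m ^ 2 + C * m + 1) - h ^ 2 * m ^ 2 := by
      have i1 : C ^ 2 * m ^ 2 ≤ C ^ 2 * m := by nlinarith [mul_nonneg (sq_nonneg C) hm0.le]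
      have i2 : C * m ≤ C ^ 2 * m := by nlinarith [mul_nonneg (by linarith : 0 ≤ C) hm0.le]
      have i3 : h * (C ^ 2 * m ^ 2 + C * m + 1) ≤ 1 / 3 * (C ^ 2 * m + C ^ 2 * m + C) := by
        gcongr
      have i4 : h ^ 2 * m ^ 2 ≤ (1 / 3) ^ 2 * 1 ^ 2 := by gcongr
      have i5 : 1 ≤ C ^ 2 * m := by nlinarith
      nlinarith
    have := mul_nonneg (sub_nonneg.2 hl') hy
    linarith
  have h6 : (1 - h * m) ≤ 1 - e * h * l := by nlinarith
  have h7 : 1 ≤ C * (C ^ 2 + h) / (C - h) * ((1 - e * h * l) / (1 + h * m ^ 2) * m ^ 2) := by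
    have : C * (C ^ 2 + h) / (C - h) * ((1 - e * h * l) / (1 + h * m ^ 2) * m ^ 2) =
      (C * (C ^ 2 + h) * (1 - e * h * l) * m ^ 2) / ((1 + h * m ^ 2) * (C - h)) := by
      field_simp
    rw [this, one_le_div (by positivity)]
    refine h5.trans ?_
    gcongr
  nlinarith [mul_le_mul_of_nonneg_right h7 (sq_nonneg p)]

/-- In the application a = ε/γ and β = √(1−ν), so the hypothesis on β² says 2ν − 1 − 4ε/γ ≥ 0, and
a/(1−a) is ε/(γ−ε). -/
theorem reference_bounds {a β : ℝ} (ha : 0 < a) (hβ : 0 ≤ β) (hβ2 : β ^ 2 ≤ 1 / 2 - 2 * a) :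
    a ≤ 1 / 4 ∧ β ≤ 3 / 4 ∧ 2 * a + β ≤ 1 ∧ 2 * a + β + a / (1 - a) ≤ 1 ∧
      a / (1 - a) ≤ 1 / 3 ∧ a / (1 - a) ≤ 4 / 3 * a := by
  have h1 : a ≤ 1 / 4 := by nlinarith
  have h5 : a / (1 - a) ≤ 4 / 3 * a := by
    rw [div_le_iff₀ (by linarith)]; nlinarith
  refine ⟨h1, by nlinarith, by nlinarith [sq_nonneg (β - 1 / 2)],
    by nlinarith [sq_nonneg (β - 3 / 10)], by linarith, h5⟩

/-- A quadratic inequality for √S. The gap between 7a/6 and 2a pays for both the weight excess h/8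
and the term a²G² from the large eigenvalues. -/
theorem weighted_norm_le {a β h G Y S : ℝ} (ha : 0 < a) (hβ : 0 ≤ β)
    (hβ2 : β ^ 2 ≤ 1 / 2 - 2 * a) (hh : h = a / (1 - a)) (hG : 0 ≤ G) (hS : 0 ≤ S)
    (hY : Y ≤ (1 + h / 8) * ((7 / 6 * a + β) * G)) (hle : S ≤ Real.sqrt S * Y + a ^ 2 * G ^ 2) :
    S ≤ (2 * a + β) ^ 2 * G ^ 2 := by
  obtain ⟨h1, h2, -, -, h3, h4⟩ := reference_bounds ha hβ hβ2
  rw [← hh] at h3 h4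
  set x := Real.sqrt S with hx
  have hx0 : 0 ≤ x := Real.sqrt_nonneg _
  have hxS : x ^ 2 = S := Real.sq_sqrt hS
  rw [← hxS] at hle ⊢
  set Z := (1 + h / 8) * (7 / 6 * a + β) with hZ
  have hZG : (1 + h / 8) * ((7 / 6 * a + β) * G) = Z * G := by rw [hZ]; ring
  rw [hZG] at hY
  have hZ1 : Z ≤ 175 / 144 * a + β + a * β / 6 := by
    rw [hZ]
    have i1 : h / 8 * (7 / 6 * a) ≤ (1 / 3) / 8 * (7 / 6 * a) := by gcongr
    have i2 : h / 8 * β ≤ (4 / 3 * a) / 8 * β := by gcongr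
    nlinarith
  have hZ2 : 95 / 144 * a ≤ 2 * a + β - Z := by nlinarith
  have hZ3 : a ^ 2 ≤ (2 * a + β) * (2 * a + β - Z) := by nlinarith
  rw [← mul_pow]
  have hxG : x ≤ (2 * a + β) * G := by
    by_contra hcon
    push Not at hcon
    have i1 : x * Y ≤ x * (Z * G) := by gcongr
    have hG0 : 0 ≤ (2 * a + β) * G := by positivity
    have hG1 : 0 ≤ (2 * a + β - Z) * G := mul_nonneg (by linarith) hG
    have i2 : ((2 * a + β) * G) * ((2 * a + β - Z) * G) < x * (x - Z * G) := by
      have : (2 * a + β - Z) * G < x - Z * G := by linarith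
      nlinarith
    nlinarith [mul_le_mul_of_nonneg_right hZ3 (sq_nonneg G)]
  gcongr

/-- The cross term 2hC(2a+β) of the square absorbs the excess of C(C²+h)/(C−h) over C²; this uses 2a
+ β + h ≤ 1. -/
theorem shift_factor_le {a β h C : ℝ} (ha : 0 < a) (hβ : 0 ≤ β)
    (hβ2 : β ^ 2 ≤ 1 / 2 - 2 * a) (hh : h = a / (1 - a)) (hC : 1 ≤ C) :
    h ^ 2 + C * (C ^ 2 + h) / (C - h) * (2 * a + β) ^ 2 ≤ (h + C * (2 * a + β)) ^ 2 := by
  obtain ⟨h1, h2, h2', h2'', h3, h4⟩ := reference_bounds ha hβ hβ2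
  rw [← hh] at h3 h4 h2''
  have hh0 : 0 < h := by rw [hh]; apply div_pos ha; linarith
  set e := 2 * a + β with he
  have he0 : 0 < e := by positivity
  have hCh : 0 < C - h := by linarith
  have key : (C ^ 2 + h) * e ≤ (C * e + 2 * h) * (C - h) := by
    have : (C * e + 2 * h) * (C - h) - (C ^ 2 + h) * e = h * (2 * C - 2 * h - e * (1 + C)) := by
      ring
    have : 0 ≤ 2 * C - 2 * h - e * (1 + C) := by nlinarith
    have := mul_nonneg hh0.le this
    linarith
  have : C * (C ^ 2 + h) / (C - h) * e ^ 2 ≤ C * e * (C * e + 2 * h) := by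
    rw [div_mul_eq_mul_div, div_le_iff₀ hCh]
    have := mul_le_mul_of_nonneg_left key (by positivity : 0 ≤ C * e)
    nlinarith
  nlinarith

/-! ### Bounds for Krylov directions in spectral coordinates -/

/-- Division by l costs a factor h on large eigenvalues and C on small nonzero ones, where w is in
turn dominated by the small part of b. -/
theorem sum_sq_le_of_small_large {ι : Type*} [Fintype ι] {l b w p : ι → ℝ} {h C G D : ℝ}
    (hh : 0 ≤ h) (hC : 0 ≤ C) (hV : ∀ i, 1 ≤ h * |l i| ∨ |l i| ≤ 1)
    (hl : ∀ i, l i ≠ 0 → 1 ≤ C * |l i|) (hp : ∀ i, |l i * p i| ≤ |w i|)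
    (hp0 : ∀ i, l i = 0 → p i = 0) (hw : ∑ i, w i ^ 2 ≤ G ^ 2)
    (hwb : ∀ i, |l i| ≤ 1 → |w i| ≤ |b i|)
    (hD : ∑ i, (if |l i| ≤ 1 then b i ^ 2 else 0) ≤ D ^ 2) :
    ∑ i, p i ^ 2 ≤ h ^ 2 * G ^ 2 + C ^ 2 * D ^ 2 := by
  have key : ∀ i, p i ^ 2 ≤ h ^ 2 * w i ^ 2 + C ^ 2 * (if |l i| ≤ 1 then b i ^ 2 else 0) := by
    intro i
    have hsq : (l i * p i) ^ 2 ≤ w i ^ 2 := sq_le_sq.2 (hp i)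
    split_ifs with h1
    · by_cases h0 : l i = 0
      · rw [hp0 i h0, zero_pow two_ne_zero]; positivity
      · have h2 : w i ^ 2 ≤ b i ^ 2 := sq_le_sq.2 (hwb i h1)
        have h3 : |p i| ≤ C * |l i| * |p i| := le_mul_of_one_le_left (abs_nonneg _) (hl i h0)
        have h4 : p i ^ 2 ≤ (C * (l i * p i)) ^ 2 := by
          apply sq_le_sq.2
          rw [abs_mul, abs_mul, abs_of_nonneg hC]; linarith
        have h5 : C ^ 2 * (l i * p i) ^ 2 ≤ C ^ 2 * b i ^ 2 :=
          mul_le_mul_of_nonneg_left (hsq.trans h2) (sq_nonneg _)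
        have h6 : 0 ≤ h ^ 2 * w i ^ 2 := by positivity
        rw [mul_pow] at h4
        linarith
    · have h2 := (hV i).resolve_right h1
      have h3 : |p i| ≤ h * |l i| * |p i| := le_mul_of_one_le_left (abs_nonneg _) h2
      have h4 : p i ^ 2 ≤ (h * (l i * p i)) ^ 2 := by
        apply sq_le_sq.2
        rw [abs_mul, abs_mul, abs_of_nonneg hh]; linarith
      have h5 : h ^ 2 * (l i * p i) ^ 2 ≤ h ^ 2 * w i ^ 2 := by gcongr
      rw [mul_pow] at h4
      linarith
  refine (Finset.sum_le_sum fun i _ => key i).trans ?_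
  rw [Finset.sum_add_distrib, ← Finset.mul_sum, ← Finset.mul_sum]
  gcongr

theorem small_large_bound_le {a β h C G : ℝ} (ha : 0 < a) (hβ : 0 ≤ β) (hh : 0 ≤ h)
    (hC : 0 ≤ C) :
    h ^ 2 * G ^ 2 + C ^ 2 * ((7 / 6 * a + β) * G) ^ 2 ≤ (h + C * (2 * a + β)) ^ 2 * G ^ 2 := by
  have h1 : C ^ 2 * ((7 / 6 * a + β) * G) ^ 2 ≤ C ^ 2 * ((2 * a + β) ^ 2 * G ^ 2) := by
    rw [mul_pow]; gcongr; norm_num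
  have h2 : 0 ≤ h * (C * (2 * a + β)) * G ^ 2 := by positivity
  nlinarith

theorem degree_lt_of_natDegree_le {P Q : ℝ[X]} {t : ℕ} (hP : P.degree < t) (hP0 : P ≠ 0)
    (hQ : Q.natDegree ≤ P.natDegree) : Q.degree < t := by
  refine lt_of_le_of_lt (degree_le_of_natDegree_le hQ) ?_
  rwa [← degree_eq_natDegree hP0]

theorem natDegree_one_sub_X_pow_mul_le (P : ℝ[X]) (n : ℕ) :
    (1 - X ^ n * P).natDegree ≤ P.natDegree + n := by
  refine (natDegree_sub_le _ _).trans ?_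
  simp only [natDegree_one, zero_le, sup_of_le_right]
  refine natDegree_mul_le.trans ?_
  rw [natDegree_X_pow, add_comm]

/-- The shifted Krylov space `K_t(A, A b)`, when some root of the residual polynomial is small. -/
theorem exists_shift_relation {ι : Type*} [Fintype ι] {l b : ι → ℝ} {P : ℝ[X]} {t : ℕ} {h : ℝ}
    (hP : P.degree < t) (hP0 : P ≠ 0) (hh : 0 < h)
    (hort : ∀ q : ℝ[X], q.degree < t →
      ∑ i, (1 - X ^ 2 * P).eval (l i) * (l i ^ 2 * q.eval (l i)) * b i ^ 2 = 0)
    (hR : 1 + 1 / h ≤ Complex.normSq (aeval (((1 / Real.sqrt h : ℝ) : ℂ) * Complex.I)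
      (1 - X ^ 2 * P))) :
    ∃ e c : ℝ, |e| ≤ 1 ∧ (1 + |e|) * (1 - h) / 2 ≤ c ∧
      ∑ i, ((1 - e * h * l i) * (((1 - X ^ 2 * P).eval (l i) * b i) *
          (b i - (1 - X ^ 2 * P).eval (l i) * b i)) -
        c * h * l i ^ 2 * ((1 - X ^ 2 * P).eval (l i) * b i) ^ 2) / (1 + h * l i ^ 2) = 0 := by
  obtain ⟨e, c, he, hc, hec⟩ := exists_shift_of_normSq hh _ hR
  refine ⟨e, c, he, hc, ?_⟩
  set r : ℝ[X] := 1 - X ^ 2 * P with hr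
  set s := Real.sqrt h with hs
  have hs0 : 0 < s := Real.sqrt_pos.2 hh
  have hs2 : s ^ 2 = h := Real.sq_sqrt hh.le
  set z : ℂ := ((1 / s : ℝ) : ℂ) * Complex.I with hz
  have hz2 : z ^ 2 = -((1 / h : ℝ) : ℂ) := by
    rw [hz, mul_pow, Complex.I_sq, ← hs2]; push_cast; ring
  have hzim : z.im ≠ 0 := by
    rw [hz]; simp; exact hs0.ne'
  have hzre : z.re = 0 := by rw [hz]; simp
  have hznorm : ‖z‖ ^ 2 = 1 / h := by
    rw [← Complex.normSq_eq_norm_sq, Complex.normSq_apply, hz, ← hs2]; simp; ring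
  -- The shift e, c is chosen exactly so that T vanishes at i/√h, hence is divisible by X² + 1/h.
  -- The quotient has degree below t and serves as test polynomial.
  set T : ℝ[X] := (1 - C (e * h) * X) * P - C (c * h) * r with hT
  have hTz : aeval z T = 0 := by
    have h1 : z ^ 2 * aeval z T = 0 := by
      rw [hT]
      simp only [map_sub, map_mul, map_one, aeval_C, aeval_X, Complex.coe_algebraMap]
      have hrz : aeval z r = 1 - z ^ 2 * aeval z P := by rw [hr]; simp
      have hk : ((e * h : ℝ) : ℂ) * z = ((e * s : ℝ) : ℂ) * Complex.I := by
        have : e * h * (1 / s) = e * s := by rw [← hs2]; field_simp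
        rw [hz, ← mul_assoc, ← Complex.ofReal_mul, this]
      have hz3 : ((c * h : ℝ) : ℂ) * z ^ 2 = -c := by
        rw [hz2, mul_neg, ← Complex.ofReal_mul]
        have : c * h * (1 / h) = c := by field_simp
        rw [this]
      rw [← hk] at hec
      simp only [Complex.ofReal_mul] at hec hz3
      linear_combination hec + (1 - (e : ℂ) * h * z) * hrz - aeval z r * hz3
    have h2 : z ^ 2 ≠ 0 := by
      intro h0
      exact hzim (by rw [pow_eq_zero_iff two_ne_zero |>.1 h0]; simp)
    exact (mul_eq_zero.1 h1).resolve_left h2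
  obtain ⟨Q, hQ⟩ := quadratic_dvd_of_aeval_eq_zero_im_ne_zero T hTz hzim
  rw [hzre, hznorm] at hQ
  have hQdeg : Q.degree < t := by
    by_cases hQ0 : Q = 0
    · rw [hQ0, degree_zero]; exact WithBot.bot_lt_coe _
    apply degree_lt_of_natDegree_le hP hP0
    have hq : (X ^ 2 - C (2 * 0) * X + C (1 / h) : ℝ[X]).natDegree = 2 := by
      have : (X ^ 2 - C (2 * 0) * X + C (1 / h) : ℝ[X]) =
        C 1 * X ^ 2 + C 0 * X + C (1 / h) := by simp
      rw [this]
      exact natDegree_quadratic one_ne_zero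
    have hne : (X ^ 2 - C (2 * 0) * X + C (1 / h) : ℝ[X]) ≠ 0 := by
      intro h0; rw [h0] at hq; simp at hq
    have h1 : T.natDegree = 2 + Q.natDegree := by rw [hQ, natDegree_mul hne hQ0, hq]
    have h2 : T.natDegree ≤ P.natDegree + 2 := by
      rw [hT]
      refine (natDegree_sub_le _ _).trans (max_le ?_ ?_)
      · refine natDegree_mul_le.trans ?_
        have : (1 - C (e * h) * X : ℝ[X]).natDegree ≤ 1 := by
          refine (natDegree_sub_le _ _).trans ?_
          simp only [natDegree_one, zero_le, sup_of_le_right]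
          exact (natDegree_C_mul_le _ _).trans natDegree_X_le
        omega
      · exact (natDegree_C_mul_le _ _).trans (natDegree_one_sub_X_pow_mul_le P 2)
    omega
  have h0 := hort Q hQdeg
  have hterm : ∀ i, ((1 - e * h * l i) * ((r.eval (l i) * b i) *
          (b i - r.eval (l i) * b i)) -
        c * h * l i ^ 2 * (r.eval (l i) * b i) ^ 2) / (1 + h * l i ^ 2) =
      h⁻¹ * (r.eval (l i) * (l i ^ 2 * Q.eval (l i)) * b i ^ 2) := by
    intro i
    have h1 : T.eval (l i) = (l i ^ 2 + 1 / h) * Q.eval (l i) := by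
      rw [hQ]; simp
    have h2 : T.eval (l i) = (1 - e * h * l i) * P.eval (l i) - c * h * r.eval (l i) := by
      rw [hT]; simp
    have h3 : r.eval (l i) = 1 - l i ^ 2 * P.eval (l i) := by rw [hr]; simp
    have h4 : 0 < 1 + h * l i ^ 2 := by positivity
    have h5 : Q.eval (l i) = h * ((1 - e * h * l i) * P.eval (l i) - c * h * r.eval (l i)) /
        (1 + h * l i ^ 2) := by
      rw [eq_div_iff h4.ne', ← h2, h1]; field_simp; ring
    rw [h5]
    field_simp
    linear_combination b i ^ 2 * r.eval (l i) * (1 - e * h * l i) * (-h3)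
  rw [Finset.sum_congr rfl fun i _ => hterm i, ← Finset.mul_sum, h0, mul_zero]

theorem sqrt_one_add_quarter_le {h D : ℝ} (hh : 0 ≤ h) (hD : 0 ≤ D) :
    Real.sqrt ((1 + h / 4) * D ^ 2) ≤ (1 + h / 8) * D := by
  rw [Real.sqrt_le_left (by positivity), mul_pow]
  gcongr
  nlinarith

theorem sum_sq_le_of_krylov_shifted {ι : Type*} [Fintype ι] {l b : ι → ℝ} {P : ℝ[X]} {t : ℕ}
    {a β h C G : ℝ} (ha : 0 < a) (hβ : 0 ≤ β) (hβ2 : β ^ 2 ≤ 1 / 2 - 2 * a)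
    (hh : h = a / (1 - a)) (hC : 1 ≤ C) (hG : 0 ≤ G)
    (hV : ∀ i, 1 ≤ h * |l i| ∨ |l i| ≤ 1) (hl : ∀ i, l i ≠ 0 → 1 ≤ C * |l i|)
    (hbG : ∑ i, b i ^ 2 ≤ G ^ 2)
    (hD : ∑ i, (if |l i| ≤ 1 then b i ^ 2 else 0) ≤ ((7 / 6 * a + β) * G) ^ 2)
    (hP : P.degree < t)
    (hort : ∀ q : ℝ[X], q.degree < t →
      ∑ i, (1 - X ^ 2 * P).eval (l i) * (l i ^ 2 * q.eval (l i)) * b i ^ 2 = 0) :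
    ∑ i, (l i * P.eval (l i) * b i) ^ 2 ≤ (h + C * (2 * a + β)) ^ 2 * G ^ 2 := by
  obtain ⟨-, -, -, -, hh3, -⟩ := reference_bounds ha hβ hβ2
  rw [← hh] at hh3
  have hh0 : 0 < h := by
    rw [hh]; exact div_pos ha (by linarith [(reference_bounds ha hβ hβ2).1])
  have hC0 : 0 ≤ C := by linarith
  by_cases hP0 : P = 0
  · simp only [hP0, eval_zero, mul_zero, zero_mul]
    simp only [ne_eq, OfNat.ofNat_ne_zero, not_false_eq_true, zero_pow, Finset.sum_const_zero]
    positivity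
  have hreval : ∀ i, (1 - X ^ 2 * P).eval (l i) = 1 - l i ^ 2 * P.eval (l i) := by
    intro i; simp
  have hr0 : (1 - X ^ 2 * P).eval 0 = 1 := by simp
  have hr1 : (1 - X ^ 2 * P).coeff 1 = 0 := by
    rw [coeff_sub, coeff_one, coeff_X_pow_mul']; simp
  have hrdeg := natDegree_one_sub_X_pow_mul_le P 2
  set r : ℝ[X] := 1 - X ^ 2 * P with hr
  have hrne : r ≠ 0 := by
    intro h0; rw [h0] at hr0; simp at hr0
  by_cases hz : ∀ i, l i * r.eval (l i) * b i = 0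
  · refine le_trans (sum_sq_le_of_small_large (w := b) hh0.le hC0 hV hl ?_ ?_ hbG
      (fun i _ => le_rfl) hD) (small_large_bound_le ha hβ hh0.le hC0)
    · intro i
      have : l i * (l i * P.eval (l i) * b i) = b i ∨ l i = 0 := by
        by_cases h0 : l i = 0
        · exact Or.inr h0
        · left
          have h1 : r.eval (l i) * b i = 0 := by
            have := hz i
            rw [mul_assoc] at this
            exact (mul_eq_zero.1 this).resolve_left h0
          rw [hreval] at h1
          linear_combination -h1
      rcases this with h1 | h1
      · rw [h1]
      · rw [h1]; simp
    · intro i h0; rw [h0]; ring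
  rcases exists_nonreal_root_or_eq_prod r hr0 with ⟨x, hx, hxi⟩ | ⟨s, hs⟩
  · exfalso
    -- Testing with the cofactor r₁ gives a vanishing sum of nonnegative terms Q·(l r₁ b)², which
    -- contradicts the failure of `hz`.
    obtain ⟨Q, r₁, h1, hQ, hdeg⟩ := exists_pos_quadratic_factor hx hxi hrne
    have h2 := hort r₁ (degree_lt_of_natDegree_le hP hP0 (by omega))
    have h3 : ∀ i, r.eval (l i) * (l i ^ 2 * r₁.eval (l i)) * b i ^ 2 =
        Q.eval (l i) * (l i * r₁.eval (l i) * b i) ^ 2 := by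
      intro i; rw [h1, eval_mul]; ring
    rw [Finset.sum_congr rfl fun i _ => h3 i,
      Finset.sum_eq_zero_iff_of_nonneg fun i _ => mul_nonneg (hQ _).le (sq_nonneg _)] at h2
    apply hz
    intro i
    have h4 := (mul_eq_zero.1 (h2 i (Finset.mem_univ i))).resolve_left (hQ _).ne'
    have h5 : l i * r₁.eval (l i) * b i = 0 := pow_eq_zero_iff two_ne_zero |>.1 h4
    rw [h1, eval_mul]
    linear_combination Q.eval (l i) * h5
  have hsum : s.sum = 0 := by
    have := (coeff_prod_one_sub s).2.1
    rw [← hs, hr1] at this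
    linarith
  set w : ι → ℝ := fun i => b i - r.eval (l i) * b i with hw
  have hwp : ∀ i, l i * (l i * P.eval (l i) * b i) = w i := by
    intro i; simp only [hw]; rw [hreval]; ring
  -- Pythagoras for b = w + rb, by orthogonality tested with P itself.
  have hwG : ∑ i, w i ^ 2 ≤ G ^ 2 := by
    have h1 := hort P hP
    have h2 : ∑ i, b i ^ 2 = ∑ i, w i ^ 2 + ∑ i, (r.eval (l i) * b i) ^ 2 +
        2 * ∑ i, r.eval (l i) * (l i ^ 2 * P.eval (l i)) * b i ^ 2 := by
      rw [Finset.mul_sum, ← Finset.sum_add_distrib, ← Finset.sum_add_distrib]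
      refine Finset.sum_congr rfl fun i _ => ?_
      simp only [hw]
      rw [hreval]; ring
    have h3 : 0 ≤ ∑ i, (r.eval (l i) * b i) ^ 2 := Finset.sum_nonneg fun i _ => sq_nonneg _
    rw [h1] at h2
    linarith
  by_cases hu : ∀ u ∈ s, |u| ≤ 1
  · refine le_trans (sum_sq_le_of_small_large (w := w) hh0.le hC0 hV hl ?_ ?_ hwG
      ?_ hD) (small_large_bound_le ha hβ hh0.le hC0)
    · intro i; rw [hwp]
    · intro i h0; rw [h0]; ring
    · intro i hi
      obtain ⟨h1, h2⟩ := eval_prod_one_sub_mem_Icc s hu hi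
      rw [hsum, zero_mul, neg_zero, Real.exp_zero] at h2
      rw [← hs] at h1 h2
      have : w i = (1 - r.eval (l i)) * b i := by simp only [hw]; ring
      rw [this, abs_mul]
      refine mul_le_of_le_one_left (abs_nonneg _) ?_
      rw [abs_of_nonneg (by linarith)]; linarith
  push Not at hu
  obtain ⟨u, hus, hu1⟩ := hu
  have hR : 1 + 1 / h ≤ Complex.normSq (aeval (((1 / Real.sqrt h : ℝ) : ℂ) * Complex.I) r) := by
    have h1 := one_add_sum_le_normSq_aeval s (1 / Real.sqrt h)
    rw [← hs] at h1
    refine le_trans ?_ h1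
    have h2 := sq_le_sum_sq_of_mem s hus
    have h3 : 1 ≤ u ^ 2 := by rw [← sq_abs]; nlinarith
    rw [div_pow, one_pow, Real.sq_sqrt hh0.le]
    have : 1 / h * 1 ≤ 1 / h * (s.map fun u => u ^ 2).sum := by gcongr; linarith
    linarith
  obtain ⟨e, c, he, hc, hrel⟩ := exists_shift_relation hP hP0 hh0 hort hR
  rw [← hr] at hrel
  -- The weight from the shift relation, kept only on small eigenvalues. The large terms are bounded
  -- separately by a²b².
  set F : ι → ℝ := fun i => if |l i| ≤ 1 then (1 - e * h * l i) / (1 + h * l i ^ 2) else 0 with hF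
  have hF0 : ∀ i, 0 ≤ F i := by
    intro i
    simp only [hF]
    split_ifs with h1
    · exact (shift_weight_bounds hh0 hh3 he h1).1
    · exact le_rfl
  set S := ∑ i, F i * w i ^ 2 with hS
  have hS0 : 0 ≤ S := Finset.sum_nonneg fun i _ => mul_nonneg (hF0 i) (sq_nonneg _)
  set D := (7 / 6 * a + β) * G with hDdef
  have hD0 : 0 ≤ D := by positivity
  have hah : (h / (1 + h)) = a := by
    have : 1 - a ≠ 0 := by
      have := (reference_bounds ha hβ hβ2).1
      intro h; linarith
    rw [hh]; field_simp; ring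
  have hineq : S ≤ ∑ i, F i * (w i * b i) + a ^ 2 * G ^ 2 := by
    have h1 : ∀ i, ((1 - e * h * l i) * ((r.eval (l i) * b i) *
          (b i - r.eval (l i) * b i)) -
        c * h * l i ^ 2 * (r.eval (l i) * b i) ^ 2) / (1 + h * l i ^ 2) ≤
        F i * (w i * b i) - F i * w i ^ 2 + a ^ 2 * b i ^ 2 := by
      intro i
      by_cases h2 : |l i| ≤ 1
      · have h3 : F i = (1 - e * h * l i) / (1 + h * l i ^ 2) := by simp only [hF, if_pos h2]
        have h4 : 0 < 1 + h * l i ^ 2 := by positivity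
        have hc0 : 0 ≤ c := by
          refine le_trans ?_ hc
          have := abs_nonneg e
          apply div_nonneg (mul_nonneg (by linarith) (by linarith)) (by norm_num)
        have h5 : 0 ≤ c * h * l i ^ 2 * (r.eval (l i) * b i) ^ 2 / (1 + h * l i ^ 2) := by
          positivity
        have h6 : 0 ≤ a ^ 2 * b i ^ 2 := by positivity
        have h7 : F i * (w i * b i) - F i * w i ^ 2 =
            (1 - e * h * l i) * ((r.eval (l i) * b i) * (b i - r.eval (l i) * b i)) /
              (1 + h * l i ^ 2) := by
          rw [h3]; simp only [hw]; ring
        rw [h7, sub_div]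
        linarith
      · have h3 : F i = 0 := by simp only [hF, if_neg h2]
        rw [h3, ← hah]
        have := shift_term_le_of_large (z := r.eval (l i) * b i) (b := b i) hh0 hh3 he
          ((hV i).resolve_right h2) hc
        linarith
    have h2 := Finset.sum_le_sum fun i (_ : i ∈ Finset.univ) => h1 i
    rw [hrel, Finset.sum_add_distrib, Finset.sum_sub_distrib, ← Finset.mul_sum] at h2
    have h3 : a ^ 2 * ∑ i, b i ^ 2 ≤ a ^ 2 * G ^ 2 := by gcongr
    linarith
  have hcs : ∑ i, F i * (w i * b i) ≤ Real.sqrt S * Real.sqrt ((1 + h / 4) * D ^ 2) := by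
    have h1 : ∀ i, F i * (w i * b i) = (Real.sqrt (F i) * w i) * (Real.sqrt (F i) * b i) := by
      intro i
      linear_combination (-(w i * b i)) * Real.mul_self_sqrt (hF0 i)
    have h2 : ∀ (v : ι → ℝ) (i : ι), (Real.sqrt (F i) * v i) ^ 2 = F i * v i ^ 2 := by
      intro v i; rw [mul_pow, Real.sq_sqrt (hF0 i)]
    rw [Finset.sum_congr rfl fun i _ => h1 i]
    refine (Real.sum_mul_le_sqrt_mul_sqrt _ _ _).trans ?_
    simp only [h2]
    gcongr
    calc ∑ i, F i * b i ^ 2 ≤ ∑ i, (1 + h / 4) * (if |l i| ≤ 1 then b i ^ 2 else 0) := by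
          apply Finset.sum_le_sum
          intro i _
          simp only [hF]
          split_ifs with h3
          · have := (shift_weight_bounds hh0 hh3 he h3).2
            gcongr
          · simp
      _ ≤ (1 + h / 4) * D ^ 2 := by rw [← Finset.mul_sum]; gcongr
  have hSle : S ≤ (2 * a + β) ^ 2 * G ^ 2 :=
    weighted_norm_le ha hβ hβ2 hh hG hS0 (sqrt_one_add_quarter_le hh0.le hD0) (by linarith)
  have hN0 : 0 ≤ C * (C ^ 2 + h) / (C - h) :=
    div_nonneg (by positivity) (by linarith)
  have hpt : ∀ i, (l i * P.eval (l i) * b i) ^ 2 ≤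
      h ^ 2 * w i ^ 2 + C * (C ^ 2 + h) / (C - h) * (F i * w i ^ 2) := by
    intro i
    by_cases h2 : |l i| ≤ 1
    · have h6 : 0 ≤ h ^ 2 * w i ^ 2 := by positivity
      by_cases h0 : l i = 0
      · have := mul_nonneg hN0 (mul_nonneg (hF0 i) (sq_nonneg (w i)))
        rw [h0] at *
        simp only [zero_mul, ne_eq, OfNat.ofNat_ne_zero, not_false_eq_true, zero_pow]
        linarith
      · have h3 := sq_le_shift_weight (p := l i * P.eval (l i) * b i) hh0 hh3 he hC h2 (hl i h0)
        rw [hwp] at h3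
        simp only [hF, if_pos h2]
        linarith
    · have h3 : F i = 0 := by simp only [hF, if_neg h2]
      rw [h3, zero_mul, mul_zero, add_zero, ← hwp i]
      have h4 := (hV i).resolve_right h2
      rw [← mul_pow]
      apply sq_le_sq.2
      rw [abs_mul h, abs_mul (l i) (l i * _ * _), abs_of_pos hh0, ← mul_assoc]
      exact le_mul_of_one_le_left (abs_nonneg _) h4
  refine (Finset.sum_le_sum fun i _ => hpt i).trans ?_
  rw [Finset.sum_add_distrib, ← Finset.mul_sum, ← Finset.mul_sum]
  have h8 := shift_factor_le ha hβ hβ2 hh hC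
  calc h ^ 2 * ∑ i, w i ^ 2 + C * (C ^ 2 + h) / (C - h) * S
      ≤ h ^ 2 * G ^ 2 + C * (C ^ 2 + h) / (C - h) * ((2 * a + β) ^ 2 * G ^ 2) := by gcongr
    _ = (h ^ 2 + C * (C ^ 2 + h) / (C - h) * (2 * a + β) ^ 2) * G ^ 2 := by ring
    _ ≤ _ := by gcongr

theorem eval_divX_mul {p : ℝ[X]} (hp : p.coeff 0 = 0) (x : ℝ) : p.eval x = x * p.divX.eval x := by
  conv_lhs => rw [← divX_mul_X_add p, hp]
  simp [mul_comm]

/-- Over the Krylov space `K_t(A, b)`, the residual-minimizing vector is no longer than the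
pseudo-inverse solution. -/
theorem sum_sq_krylov_le_sum_sq_div {ι : Type*} [Fintype ι] {l b : ι → ℝ} {P : ℝ[X]} {t : ℕ}
    (hb : ∀ i, l i = 0 → b i = 0) (hP : P.degree < t)
    (hort : ∀ q : ℝ[X], q.degree < t →
      ∑ i, (1 - X ^ 1 * P).eval (l i) * (l i * q.eval (l i)) * b i ^ 2 = 0) :
    ∑ i, (P.eval (l i) * b i) ^ 2 ≤ ∑ i, (b i / l i) ^ 2 := by
  by_cases hP0 : P = 0
  · simp only [hP0, eval_zero, zero_mul]
    exact Finset.sum_le_sum fun i _ => by rw [zero_pow two_ne_zero]; positivity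
  have hreval : ∀ i, (1 - X ^ 1 * P).eval (l i) = 1 - l i * P.eval (l i) := by
    intro i; simp
  have hr0 : (1 - X ^ 1 * P).eval 0 = 1 := by simp
  have hr1 : (1 - X ^ 1 * P).coeff 1 = -P.coeff 0 := by
    rw [coeff_sub, coeff_one, coeff_X_pow_mul']; simp
  have hr2 : (1 - X ^ 1 * P).coeff 2 = -P.coeff 1 := by
    rw [coeff_sub, coeff_one, coeff_X_pow_mul']; simp
  have hrc : (1 - X ^ 1 * P).coeff 0 = 1 := by
    rw [coeff_sub, coeff_one, coeff_X_pow_mul']; simp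
  have hrdeg := natDegree_one_sub_X_pow_mul_le P 1
  set r : ℝ[X] := 1 - X ^ 1 * P with hr
  have hrne : r ≠ 0 := by
    intro h0; rw [h0] at hr0; simp at hr0
  rcases exists_nonreal_root_or_eq_prod r hr0 with ⟨x, hx, hxi⟩ | ⟨s, hs⟩
  · obtain ⟨Q, r₁, h1, hQ, hdeg⟩ := exists_pos_quadratic_factor hx hxi hrne
    have h2 := hort (X * r₁) (degree_lt_of_natDegree_le hP hP0
      (natDegree_mul_le.trans (by rw [natDegree_X]; omega)))
    have h3 : ∀ i, r.eval (l i) * (l i * (X * r₁).eval (l i)) * b i ^ 2 =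
        Q.eval (l i) * (l i * r₁.eval (l i) * b i) ^ 2 := by
      intro i; rw [h1, eval_mul, eval_mul, eval_X]; ring
    rw [Finset.sum_congr rfl fun i _ => h3 i,
      Finset.sum_eq_zero_iff_of_nonneg fun i _ => mul_nonneg (hQ _).le (sq_nonneg _)] at h2
    refine Finset.sum_le_sum fun i _ => le_of_eq ?_
    by_cases h0 : l i = 0
    · simp [hb i h0]
    have h4 := (mul_eq_zero.1 (h2 i (Finset.mem_univ i))).resolve_left (hQ _).ne'
    have h5 : l i * r₁.eval (l i) * b i = 0 := pow_eq_zero_iff two_ne_zero |>.1 h4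
    have h6 : r₁.eval (l i) * b i = 0 := by
      rw [mul_assoc] at h5
      exact (mul_eq_zero.1 h5).resolve_left h0
    have h7 : r.eval (l i) * b i = 0 := by
      rw [h1, eval_mul]
      linear_combination Q.eval (l i) * h6
    rw [hreval] at h7
    congr 1
    rw [eq_div_iff h0]
    linear_combination -h7
  set m := r.coeff 1 with hm
  obtain ⟨-, hs1, hs2⟩ := coeff_prod_one_sub s
  rw [← hs] at hs1 hs2
  -- The quantity is ∑u², by Newton's identity.
  have hm2 : 0 ≤ m ^ 2 - 2 * r.coeff 2 := by
    have : 0 ≤ (s.map fun u => u ^ 2).sum :=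
      Multiset.sum_nonneg (by simp only [Multiset.mem_map]; rintro _ ⟨u, -, rfl⟩; positivity)
    rw [hs2, hm, hs1]
    linarith
  set T₀ : ℝ[X] := P + C m * r with hT₀
  have hT₀0 : T₀.coeff 0 = 0 := by rw [hT₀, coeff_add, coeff_C_mul, hrc, hr1]; ring
  set T := T₀.divX with hT
  have hTc : T.coeff 0 = m ^ 2 - r.coeff 2 := by
    rw [hT, coeff_divX, hT₀, coeff_add, coeff_C_mul, hr2, zero_add, ← hm]; ring
  have hTdeg : T.natDegree ≤ P.natDegree := by
    rw [hT, natDegree_divX_eq_natDegree_tsub_one]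
    have : T₀.natDegree ≤ P.natDegree + 1 :=
      (natDegree_add_le _ _).trans (max_le (by omega) ((natDegree_C_mul_le _ _).trans hrdeg))
    omega
  set V₀ : ℝ[X] := T - C (T.coeff 0) * r with hV₀
  have hV₀0 : V₀.coeff 0 = 0 := by rw [hV₀, coeff_sub, coeff_C_mul, hrc]; ring
  have hVdeg : V₀.divX.natDegree ≤ P.natDegree := by
    rw [natDegree_divX_eq_natDegree_tsub_one]
    have : V₀.natDegree ≤ P.natDegree + 1 :=
      (natDegree_sub_le _ _).trans (max_le (by omega) ((natDegree_C_mul_le _ _).trans hrdeg))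
    omega
  have h1 := hort V₀.divX (degree_lt_of_natDegree_le hP hP0 hVdeg)
  -- Two nonnegative terms plus a multiple of the residual orthogonality relation. Subtracting the
  -- constant terms in `T₀` and `V₀` makes both divisible by X and keeps the test polynomial within
  -- the degree bound.
  have h2 : ∀ i, (b i / l i) ^ 2 - (P.eval (l i) * b i) ^ 2 =
      (r.eval (l i) * (1 - m * l i) * b i / l i) ^ 2 +
        (m ^ 2 - 2 * r.coeff 2) * (r.eval (l i) * b i) ^ 2 +
        2 * (r.eval (l i) * (l i * V₀.divX.eval (l i)) * b i ^ 2) := by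
    intro i
    by_cases h0 : l i = 0
    · simp [hb i h0]
    have hV : V₀.eval (l i) = T.eval (l i) - (m ^ 2 - r.coeff 2) * r.eval (l i) := by
      rw [← hTc, hV₀, eval_sub, eval_mul, eval_C]
    rw [← eval_divX_mul hV₀0, hV]
    have h3 : T.eval (l i) = (P.eval (l i) + m * r.eval (l i)) / l i := by
      rw [eq_div_iff h0, mul_comm, ← eval_divX_mul hT₀0, hT₀, eval_add, eval_mul, eval_C]
    have h4 : P.eval (l i) = (1 - r.eval (l i)) / l i := by
      rw [eq_div_iff h0, hreval]; ring
    rw [h3, h4]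
    field_simp
    ring
  rw [← sub_nonneg, ← Finset.sum_sub_distrib, Finset.sum_congr rfl fun i _ => h2 i,
    Finset.sum_add_distrib, ← Finset.mul_sum _ _ (2 : ℝ), h1, mul_zero, add_zero]
  exact Finset.sum_nonneg fun i _ => add_nonneg (sq_nonneg _) (mul_nonneg hm2 (sq_nonneg _))

theorem sum_sq_le_of_krylov {ι : Type*} [Fintype ι] {l b : ι → ℝ} {P : ℝ[X]} {t : ℕ}
    {a β h C G : ℝ} (ha : 0 < a) (hβ : 0 ≤ β) (hh : 0 ≤ h) (hC : 0 ≤ C)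
    (hV : ∀ i, 1 ≤ h * |l i| ∨ |l i| ≤ 1) (hl : ∀ i, l i ≠ 0 → 1 ≤ C * |l i|)
    (hbG : ∑ i, b i ^ 2 ≤ G ^ 2)
    (hD : ∑ i, (if |l i| ≤ 1 then b i ^ 2 else 0) ≤ ((7 / 6 * a + β) * G) ^ 2)
    (hb : ∀ i, l i = 0 → b i = 0) (hP : P.degree < t)
    (hort : ∀ q : ℝ[X], q.degree < t →
      ∑ i, (1 - X ^ 1 * P).eval (l i) * (l i * q.eval (l i)) * b i ^ 2 = 0) :
    ∑ i, (P.eval (l i) * b i) ^ 2 ≤ (h + C * (2 * a + β)) ^ 2 * G ^ 2 := by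
  refine (sum_sq_krylov_le_sum_sq_div hb hP hort).trans
    ((sum_sq_le_of_small_large (w := b) hh hC hV hl ?_ ?_ hbG (fun i _ => le_rfl) hD).trans
      (small_large_bound_le ha hβ hh hC))
  · intro i
    by_cases h0 : l i = 0
    · simp [h0]
    · rw [mul_div_cancel₀ _ h0]
  · intro i h0; rw [h0, div_zero]

/-! ### Perturbations of a symmetric operator -/

section Perturbation

variable {d : ℕ}

theorem apply_eq_zero_of_mem_orthogonal_rangeOf {H : Op d}
    (hH : ∀ x y, inner ℝ (H x) y = inner ℝ x (H y)) {v : Vec d} (hv : v ∈ (rangeOf H)ᗮ) :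
    H v = 0 := by
  have h1 : inner ℝ (H (H v)) v = 0 := (Submodule.mem_orthogonal _ _).1 hv _ ⟨H v, rfl⟩
  rw [hH] at h1
  exact inner_self_eq_zero.1 h1

theorem apply_starProjection_rangeOf {H : Op d}
    (hH : ∀ x y, inner ℝ (H x) y = inner ℝ x (H y)) (v : Vec d) :
    H ((rangeOf H).starProjection v) = H v := by
  have := apply_eq_zero_of_mem_orthogonal_rangeOf hH
    ((rangeOf H).sub_starProjection_mem_orthogonal v)
  rw [map_sub, sub_eq_zero] at this
  exact this.symm

/-- The gap in the spectrum of a perturbation `H + E`. -/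
theorem eigenvalue_dichotomy {H E : Op d} {γ ε l : ℝ} {v : Vec d}
    (hH : ∀ x y, inner ℝ (H x) y = inner ℝ x (H y))
    (hγ : ∀ p ∈ rangeOf H, γ * ‖p‖ ≤ ‖H p‖) (hE : ‖E‖ ≤ ε) (hε : 0 ≤ ε) (hv : v ≠ 0)
    (hl : (H + E) v = l • v) : |l| ≤ ε ∨ γ - ε ≤ |l| := by
  by_contra! hcon
  obtain ⟨h1, h2⟩ := hcon
  set U := rangeOf H with hU
  set a := U.starProjection v with ha
  have haU : a ∈ U := U.starProjection_apply_mem v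
  have hb : v - a ∈ Uᗮ := U.sub_starProjection_mem_orthogonal v
  have hHa : H a = H v := apply_starProjection_rangeOf hH v
  -- The two pieces are orthogonal and have norms at least (γ−|l|)‖a‖ and |l|‖v−a‖. If both factors
  -- exceeded ε, then ‖Ev‖ would exceed ε‖v‖.
  have hEv : E v = (l • a - H a) + l • (v - a) := by
    have : H v + E v = l • v := hl
    rw [hHa, smul_sub, ← this]; abel
  have hmem : l • a - H a ∈ U := U.sub_mem (U.smul_mem l haU) ⟨a, rfl⟩
  have hpy : ‖E v‖ ^ 2 = ‖l • a - H a‖ ^ 2 + ‖l • (v - a)‖ ^ 2 := by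
    rw [hEv, sq, sq, sq]
    exact norm_add_sq_eq_norm_sq_add_norm_sq_real
      (Submodule.inner_right_of_mem_orthogonal hmem (Uᗮ.smul_mem l hb))
  have hpyv : ‖v‖ ^ 2 = ‖a‖ ^ 2 + ‖v - a‖ ^ 2 := by
    have := norm_add_sq_eq_norm_sq_add_norm_sq_real
      (Submodule.inner_right_of_mem_orthogonal haU hb)
    rw [add_sub_cancel] at this
    rw [sq, sq, sq]; exact this
  have hla : (γ - |l|) * ‖a‖ ≤ ‖l • a - H a‖ := by
    have h3 := norm_sub_norm_le (H a) (l • a)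
    rw [norm_smul, Real.norm_eq_abs, norm_sub_rev] at h3
    have := hγ a haU
    linarith
  have hvpos : 0 < ‖v‖ := norm_pos_iff.2 hv
  have hEn : ‖E v‖ ≤ ε * ‖v‖ := (E.le_opNorm v).trans (by gcongr)
  rw [norm_smul, Real.norm_eq_abs, mul_pow] at hpy
  have h4 : ‖E v‖ ^ 2 ≤ ε ^ 2 * ‖v‖ ^ 2 := by rw [← mul_pow]; gcongr
  have h5 : ((γ - |l|) * ‖a‖) ^ 2 ≤ ‖l • a - H a‖ ^ 2 := by
    have : 0 ≤ (γ - |l|) * ‖a‖ := mul_nonneg (by linarith) (norm_nonneg _)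
    gcongr
  set m := min (γ - |l|) |l| with hm
  have hmε : ε < m := lt_min (by linarith) h1
  have hm0 : 0 ≤ m := hε.trans hmε.le
  have h6 : m ^ 2 * ‖a‖ ^ 2 ≤ (γ - |l|) ^ 2 * ‖a‖ ^ 2 := by
    have := min_le_left (γ - |l|) |l|
    gcongr
  have h7 : m ^ 2 * ‖v - a‖ ^ 2 ≤ |l| ^ 2 * ‖v - a‖ ^ 2 := by
    have := min_le_right (γ - |l|) |l|
    gcongr
  have h8 : m ^ 2 * ‖v‖ ^ 2 ≤ ε ^ 2 * ‖v‖ ^ 2 := by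
    rw [mul_pow] at h5
    calc m ^ 2 * ‖v‖ ^ 2 = m ^ 2 * ‖a‖ ^ 2 + m ^ 2 * ‖v - a‖ ^ 2 := by rw [hpyv]; ring
      _ ≤ _ := by linarith
  have h9 := le_of_mul_le_mul_right h8 (by positivity)
  nlinarith

theorem norm_starProjection_rangeOf_le {H E : Op d} {γ ε : ℝ} {w : Vec d}
    (hH : ∀ x y, inner ℝ (H x) y = inner ℝ x (H y))
    (hγ : ∀ p ∈ rangeOf H, γ * ‖p‖ ≤ ‖H p‖) (hE : ‖E‖ ≤ ε) (hw : ‖(H + E) w‖ ≤ ε * ‖w‖) :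
    γ * ‖(rangeOf H).starProjection w‖ ≤ 2 * ε * ‖w‖ := by
  have h1 := hγ _ ((rangeOf H).starProjection_apply_mem w)
  rw [apply_starProjection_rangeOf hH] at h1
  have h2 : H w = (H + E) w - E w := by simp
  have h3 := norm_sub_le ((H + E) w) (E w)
  rw [← h2] at h3
  have h4 : ‖E w‖ ≤ ε * ‖w‖ := (E.le_opNorm w).trans (by gcongr)
  linarith

/-- The commutator of an operator with an orthogonal projection. -/
theorem norm_commutator_starProjection_le (E : Op d) (W : Submodule ℝ (Vec d)) {ε : ℝ}
    (hE : ‖E‖ ≤ ε) (u : Vec d) :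
    ‖E (W.starProjection u) - W.starProjection (E u)‖ ≤ ε * ‖u‖ := by
  have hε : 0 ≤ ε := (norm_nonneg E).trans hE
  set a := W.starProjection u with ha
  have haW : a ∈ W := W.starProjection_apply_mem u
  have hb : u - a ∈ Wᗮ := W.sub_starProjection_mem_orthogonal u
  -- The pieces lie in Wᗮ and W and come from the orthogonal components of u, so the constant is ε
  -- rather than 2ε.
  have e : E a - W.starProjection (E u) =
      (E a - W.starProjection (E a)) + -W.starProjection (E (u - a)) := by
    rw [map_sub, map_sub]; abel
  have h1 : ‖E a - W.starProjection (E u)‖ ^ 2 =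
      ‖E a - W.starProjection (E a)‖ ^ 2 + ‖W.starProjection (E (u - a))‖ ^ 2 := by
    rw [e, sq, sq, sq, ← norm_neg (W.starProjection (E (u - a)))]
    exact norm_add_sq_eq_norm_sq_add_norm_sq_real
      (Submodule.inner_left_of_mem_orthogonal (W.neg_mem (W.starProjection_apply_mem _))
        (W.sub_starProjection_mem_orthogonal _))
  have h2 : ‖E a - W.starProjection (E a)‖ ≤ ε * ‖a‖ := by
    have h3 : E a - W.starProjection (E a) = Wᗮ.starProjection (E a) := by
      rw [Submodule.starProjection_orthogonal_val]
    rw [h3]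
    exact (Wᗮ.norm_starProjection_apply_le _).trans ((E.le_opNorm a).trans (by gcongr))
  have h3 : ‖W.starProjection (E (u - a))‖ ≤ ε * ‖u - a‖ :=
    (W.norm_starProjection_apply_le _).trans ((E.le_opNorm _).trans (by gcongr))
  have hpy : ‖u‖ ^ 2 = ‖a‖ ^ 2 + ‖u - a‖ ^ 2 := by
    have := norm_add_sq_eq_norm_sq_add_norm_sq_real
      (Submodule.inner_right_of_mem_orthogonal haW hb)
    rw [add_sub_cancel] at this
    rw [sq, sq, sq]; exact this
  refine le_of_sq_le_sq ?_ (by positivity)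
  rw [h1, mul_pow, hpy, mul_add, ← mul_pow, ← mul_pow]
  gcongr

/-- Projection of the range of `H` on a subspace where the perturbed operator is small. -/
theorem norm_starProjection_le_of_mem_rangeOf {H E : Op d} {γ ε : ℝ} {W : Submodule ℝ (Vec d)}
    {u : Vec d} (hH : ∀ x y, inner ℝ (H x) y = inner ℝ x (H y)) (hγ0 : 0 < γ)
    (hγ : ∀ p ∈ rangeOf H, γ * ‖p‖ ≤ ‖H p‖) (hE : ‖E‖ ≤ ε) (hεγ : ε ≤ γ / 4)
    (hcomm : ∀ x, (H + E) (W.starProjection x) = W.starProjection ((H + E) x))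
    (hW : ∀ w ∈ W, ‖(H + E) w‖ ≤ ε * ‖w‖) (hu : u ∈ rangeOf H) :
    ‖W.starProjection u‖ ≤ 7 / 6 * (ε / γ) * ‖u‖ := by
  have hε : 0 ≤ ε := (norm_nonneg E).trans hE
  set U := rangeOf H with hU
  obtain ⟨u₀, hu₀⟩ := hu
  have hu₀ : H u₀ = u := hu₀
  set u' := U.starProjection u₀ with hu'
  have hHu : H u' = u := by rw [hu', apply_starProjection_rangeOf hH, hu₀]
  have hn : γ * ‖u'‖ ≤ ‖u‖ := by
    rw [← hHu]; exact hγ _ (U.starProjection_apply_mem _)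
  set P := W.starProjection with hP
  set v := Uᗮ.starProjection (P u) with hv
  have hvU : v ∈ Uᗮ := Uᗮ.starProjection_apply_mem _
  have hv1 : ‖v‖ ≤ ε * ‖u'‖ := by
    -- Because P commutes with H + E, the component of Pu orthogonal to the range of H comes only
    -- from the commutator of E and P.
    have h1 : P u = H (P u') + (E (P u') - P (E u')) := by
      have h2 := hcomm u'
      rw [_root_.add_apply, _root_.add_apply, map_add, hHu] at h2
      rw [← add_sub_assoc, h2]; abel
    have h2 : inner ℝ v (P u) = ‖v‖ ^ 2 := by
      have h3 : inner ℝ v (P u - v) = 0 :=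
        Submodule.inner_right_of_mem_orthogonal hvU (Uᗮ.sub_starProjection_mem_orthogonal _)
      rw [inner_sub_right, sub_eq_zero, real_inner_self_eq_norm_sq] at h3
      exact h3
    have h4 : inner ℝ v (H (P u')) = 0 :=
      Submodule.inner_left_of_mem_orthogonal (K := U) ⟨P u', rfl⟩ hvU
    rw [h1, inner_add_right, h4, zero_add] at h2
    have h5 := real_inner_le_norm v (E (P u') - P (E u'))
    have h6 := norm_commutator_starProjection_le E W hE u'
    rw [h2, sq] at h5
    rcases (norm_nonneg v).eq_or_lt with h7 | h7
    · rw [← h7]; positivity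
    · exact (le_of_mul_le_mul_left h5 h7).trans h6
  have hv2 : ‖v‖ ≤ ε / γ * ‖u‖ := by
    refine hv1.trans ?_
    rw [div_mul_eq_mul_div, le_div_iff₀ hγ0]
    nlinarith
  have hw : γ * ‖U.starProjection (P u)‖ ≤ 2 * ε * ‖P u‖ :=
    norm_starProjection_rangeOf_le hH hγ hE (hW _ (W.starProjection_apply_mem _))
  have hw2 : ‖U.starProjection (P u)‖ ≤ 1 / 2 * ‖P u‖ := by
    have : γ * ‖U.starProjection (P u)‖ ≤ γ * (1 / 2 * ‖P u‖) := by
      refine hw.trans ?_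
      nlinarith [norm_nonneg (P u)]
    exact le_of_mul_le_mul_left this hγ0
  have hpy := Submodule.norm_sq_eq_add_norm_sq_starProjection (P u) U
  rw [← hv] at hpy
  have h8 : ‖U.starProjection (P u)‖ ^ 2 ≤ (1 / 2 * ‖P u‖) ^ 2 := by gcongr
  have h9 : ‖v‖ ^ 2 ≤ (ε / γ * ‖u‖) ^ 2 := by gcongr
  refine le_of_sq_le_sq ?_ (by positivity)
  -- The estimates give (3/4)‖Pu‖² ≤ (ε‖u‖/γ)², and 4/3 ≤ 49/36.
  have : (7 / 6 * (ε / γ) * ‖u‖) ^ 2 = 49 / 36 * (ε / γ * ‖u‖) ^ 2 := by ring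
  rw [this]
  nlinarith [sq_nonneg (ε / γ * ‖u‖)]

theorem norm_starProjection_orthogonal_le {U : Submodule ℝ (Vec d)} {g : Vec d} {ν : ℝ}
    (hν0 : 0 < ν) (hν1 : ν ≤ 1)
    (h : ‖Uᗮ.starProjection g‖ ^ 2 ≤ (1 - ν) / ν * ‖U.starProjection g‖ ^ 2) :
    ‖Uᗮ.starProjection g‖ ≤ Real.sqrt (1 - ν) * ‖g‖ ∧ ν * ‖g‖ ^ 2 ≤ ‖U.starProjection g‖ ^ 2 := by
  have hpy := Submodule.norm_sq_eq_add_norm_sq_starProjection g U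
  rw [div_mul_eq_mul_div, le_div_iff₀ hν0] at h
  constructor
  · refine le_of_sq_le_sq ?_ (by positivity)
    rw [mul_pow, Real.sq_sqrt (by linarith), hpy]
    nlinarith
  · rw [hpy]; nlinarith

theorem norm_starProjection_gradient_le {H E : Op d} {γ ε ν : ℝ} {W : Submodule ℝ (Vec d)}
    {g : Vec d} (hH : ∀ x y, inner ℝ (H x) y = inner ℝ x (H y)) (hγ0 : 0 < γ)
    (hγ : ∀ p ∈ rangeOf H, γ * ‖p‖ ≤ ‖H p‖) (hE : ‖E‖ ≤ ε) (hεγ : ε ≤ γ / 4)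
    (hcomm : ∀ x, (H + E) (W.starProjection x) = W.starProjection ((H + E) x))
    (hW : ∀ w ∈ W, ‖(H + E) w‖ ≤ ε * ‖w‖) (hν0 : 0 < ν) (hν1 : ν ≤ 1)
    (hg : ‖(rangeOf H)ᗮ.starProjection g‖ ^ 2 ≤
      (1 - ν) / ν * ‖(rangeOf H).starProjection g‖ ^ 2) :
    ‖W.starProjection g‖ ≤ (7 / 6 * (ε / γ) + Real.sqrt (1 - ν)) * ‖g‖ := by
  have hε : 0 ≤ ε := (norm_nonneg E).trans hE
  set U := rangeOf H with hU
  have h1 : U.starProjection g + Uᗮ.starProjection g = g := by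
    rw [Submodule.starProjection_orthogonal_val]; abel
  have h2 := norm_starProjection_le_of_mem_rangeOf hH hγ0 hγ hE hεγ hcomm hW
    (U.starProjection_apply_mem g)
  have h3 : ‖W.starProjection (Uᗮ.starProjection g)‖ ≤ ‖Uᗮ.starProjection g‖ :=
    W.norm_starProjection_apply_le _
  have h4 := (norm_starProjection_orthogonal_le hν0 hν1 hg).1
  have h5 : ‖U.starProjection g‖ ≤ ‖g‖ := U.norm_starProjection_apply_le g
  calc ‖W.starProjection g‖ = ‖W.starProjection (U.starProjection g) +
        W.starProjection (Uᗮ.starProjection g)‖ := by rw [← map_add, h1]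
    _ ≤ _ := norm_add_le _ _
    _ ≤ 7 / 6 * (ε / γ) * ‖g‖ + Real.sqrt (1 - ν) * ‖g‖ := by
      refine add_le_add (h2.trans ?_) (h3.trans h4)
      gcongr
    _ = _ := by ring

end Perturbation

/-! ### Spectral coordinates -/

section Spectral

variable {d : ℕ}

theorem inner_eigenvector_apply {A : Op d} {l : ℝ} {v : Vec d}
    (hA : ∀ x y, inner ℝ (A x) y = inner ℝ x (A y)) (hv : A v = l • v) (x : Vec d) :
    inner ℝ v (A x) = l * inner ℝ v x := by
  rw [← hA, hv, real_inner_smul_left]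

theorem inner_eigenvector_aeval {A : Op d} {l : ℝ} {v : Vec d}
    (hA : ∀ x y, inner ℝ (A x) y = inner ℝ x (A y)) (hv : A v = l • v) (Q : ℝ[X]) (x : Vec d) :
    inner ℝ v ((aeval A Q) x) = Q.eval l * inner ℝ v x := by
  induction Q using Polynomial.induction_on generalizing x with
  | C a => simp [Algebra.algebraMap_eq_smul_one, real_inner_smul_right]
  | add p q hp hq => rw [map_add, _root_.add_apply, inner_add_right, hp, hq, eval_add, add_mul]
  | monomial n a ih =>
    have e : (aeval A (C a * X ^ (n + 1) : ℝ[X])) x = (aeval A (C a * X ^ n : ℝ[X])) (A x) := by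
      rw [pow_succ, ← mul_assoc, map_mul, aeval_X]; rfl
    rw [e, ih, inner_eigenvector_apply hA hv]
    simp only [eval_mul, eval_C, eval_pow, eval_X]
    ring

theorem mem_krylov_iff {A : Op d} {b x : Vec d} {t : ℕ} :
    x ∈ krylov A b t ↔ ∃ Q : ℝ[X], Q.degree < t ∧ (aeval A Q) b = x := by
  classical
  let T : ℝ[X] →ₗ[ℝ] Vec d :=
    { toFun := fun Q => (aeval A Q) b
      map_add' := fun p q => by rw [map_add]; rfl
      map_smul' := fun c q => by rw [map_smul]; rfl }
  have h : krylov A b t = (degreeLT ℝ t).map T := by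
    rw [degreeLT_eq_span_X_pow, Submodule.map_span, krylov]
    congr 1
    ext y
    simp [T]
  rw [h, Submodule.mem_map]
  simp only [mem_degreeLT]
  rfl

theorem inner_residual_eq_zero {A : Op d} {g p q : Vec d} {K : Submodule ℝ (Vec d)}
    (hp : p ∈ residualMinimizers A g K) (hq : q ∈ K) : inner ℝ (A p + g) (A q) = 0 := by
  by_contra hne
  have hA0 : A q ≠ 0 := by
    intro h; rw [h, inner_zero_right] at hne; exact hne rfl
  have hpos : 0 < ‖A q‖ ^ 2 := by have := norm_pos_iff.2 hA0; positivity
  set c := inner ℝ (A p + g) (A q) with hc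
  have h1 := hp.2 (p + (-(c / ‖A q‖ ^ 2)) • q) (K.add_mem hp.1 (K.smul_mem _ hq))
  have h2 : A (p + (-(c / ‖A q‖ ^ 2)) • q) + g = (A p + g) + (-(c / ‖A q‖ ^ 2)) • A q := by
    rw [map_add, map_smul]; abel
  rw [h2] at h1
  have h3 := norm_add_sq_real (A p + g) ((-(c / ‖A q‖ ^ 2)) • A q)
  rw [real_inner_smul_right, ← hc, norm_smul, mul_pow, Real.norm_eq_abs, sq_abs] at h3
  have h4 : ‖A p + g‖ ^ 2 ≤ ‖A p + g + (-(c / ‖A q‖ ^ 2)) • A q‖ ^ 2 := by gcongr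
  have h5 : 2 * (-(c / ‖A q‖ ^ 2) * c) + (-(c / ‖A q‖ ^ 2)) ^ 2 * ‖A q‖ ^ 2 =
      -(c ^ 2 / ‖A q‖ ^ 2) := by field_simp; ring
  have h6 : 0 < c ^ 2 / ‖A q‖ ^ 2 := by positivity
  linarith

theorem norm_apply_le_of_mem_residualMinimizers {A : Op d} {g p : Vec d} {K : Submodule ℝ (Vec d)}
    (hp : p ∈ residualMinimizers A g K) : ‖A p‖ ≤ ‖g‖ := by
  have h1 := inner_residual_eq_zero hp hp.1
  have h2 : ‖g‖ ^ 2 = ‖A p + g‖ ^ 2 + ‖A p‖ ^ 2 := by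
    have h3 := norm_sub_sq_real (A p + g) (A p)
    rw [h1, add_sub_cancel_left] at h3
    linarith
  exact le_of_sq_le_sq (by nlinarith [sq_nonneg ‖A p + g‖]) (norm_nonneg _)

/-- For l ≠ 0 the Penrose equation AXA = A gives AXv = v, so l⟨v, Xv⟩ = 1. -/
theorem one_le_mul_abs_eigenvalue {A X : Op d} {ε C l : ℝ} {v : Vec d}
    (hA : ∀ x y, inner ℝ (A x) y = inner ℝ x (A y)) (hX : IsMoorePenroseInverse A X)
    (hXn : ‖X‖ ≤ C / ε) (hv1 : ‖v‖ = 1) (hv : A v = l • v) (hl : l ≠ 0) :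
    1 ≤ C / ε * |l| := by
  have h1 : A (X (A v)) = A v := by
    have := congrArg (fun B : Op d => B v) hX.1
    simpa using this
  rw [hv, map_smul, map_smul] at h1
  have h2 : A (X v) = v := smul_right_injective _ hl h1
  have h3 : l * inner ℝ v (X v) = 1 := by
    rw [← inner_eigenvector_apply hA hv, h2, real_inner_self_eq_norm_sq, hv1, one_pow]
  have h4 : |inner ℝ v (X v)| ≤ C / ε := by
    refine (abs_real_inner_le_norm _ _).trans ?_
    rw [hv1, one_mul]
    refine (X.le_opNorm v).trans ?_
    rw [hv1, mul_one]; exact hXn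
  calc (1 : ℝ) = |l * inner ℝ v (X v)| := by rw [h3, abs_one]
    _ = |inner ℝ v (X v)| * |l| := by rw [abs_mul, mul_comm]
    _ ≤ _ := by gcongr

/-- The span of the basis vectors with indices in `S`, given by the vanishing of the other
coordinates. -/
def coordSubspace (v : OrthonormalBasis (Fin d) ℝ (Vec d)) (S : Set (Fin d)) :
    Submodule ℝ (Vec d) where
  carrier := {x | ∀ i ∉ S, inner ℝ (v i) x = 0}
  add_mem' := fun hx hy i hi => by rw [inner_add_right, hx i hi, hy i hi, add_zero]
  zero_mem' := fun i _ => inner_zero_right _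
  smul_mem' := fun c x hx i hi => by rw [real_inner_smul_right, hx i hi, mul_zero]

theorem sum_sq_inner (v : OrthonormalBasis (Fin d) ℝ (Vec d)) (x : Vec d) :
    ∑ i, inner ℝ (v i) x ^ 2 = ‖x‖ ^ 2 := by
  rw [← v.sum_sq_norm_inner_right x]
  simp

theorem basis_mem_coordSubspace (v : OrthonormalBasis (Fin d) ℝ (Vec d)) {S : Set (Fin d)}
    {i : Fin d} (hi : i ∈ S) : v i ∈ coordSubspace v S := by
  intro j hj
  exact v.orthonormal.2 (fun h => hj (h ▸ hi))

theorem sum_sq_inner_le_norm_starProjection (v : OrthonormalBasis (Fin d) ℝ (Vec d))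
    (S : Set (Fin d)) [DecidablePred (· ∈ S)] (g : Vec d) :
    ∑ i, (if i ∈ S then inner ℝ (v i) g ^ 2 else 0) ≤ ‖(coordSubspace v S).starProjection g‖ ^ 2 := by
  rw [← sum_sq_inner v]
  refine Finset.sum_le_sum fun i _ => ?_
  split_ifs with hi
  · rw [← Submodule.inner_starProjection_left_eq_right,
      (Submodule.starProjection_eq_self_iff).2 (basis_mem_coordSubspace v hi)]
  · positivity

theorem apply_starProjection_coordSubspace {A : Op d} {l : Fin d → ℝ}
    (v : OrthonormalBasis (Fin d) ℝ (Vec d)) (S : Set (Fin d))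
    (hA : ∀ x y, inner ℝ (A x) y = inner ℝ x (A y)) (hv : ∀ i, A (v i) = l i • v i) (x : Vec d) :
    A ((coordSubspace v S).starProjection x) = (coordSubspace v S).starProjection (A x) := by
  have hinv : ∀ y ∈ coordSubspace v S, A y ∈ coordSubspace v S := by
    intro y hy i hi
    rw [inner_eigenvector_apply hA (hv i), hy i hi, mul_zero]
  symm
  apply Submodule.eq_starProjection_of_mem_orthogonal
  · exact hinv _ (Submodule.starProjection_apply_mem _ _)
  · rw [← map_sub, Submodule.mem_orthogonal]
    intro y hy
    rw [← hA]
    exact (Submodule.mem_orthogonal _ _).1 (Submodule.sub_starProjection_mem_orthogonal x) _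
      (hinv y hy)

theorem norm_apply_le_of_mem_coordSubspace {A : Op d} {l : Fin d → ℝ} {ε : ℝ}
    (v : OrthonormalBasis (Fin d) ℝ (Vec d)) {S : Set (Fin d)} (hε : 0 ≤ ε)
    (hA : ∀ x y, inner ℝ (A x) y = inner ℝ x (A y)) (hv : ∀ i, A (v i) = l i • v i)
    (hS : ∀ i ∈ S, |l i| ≤ ε) {w : Vec d} (hw : w ∈ coordSubspace v S) :
    ‖A w‖ ≤ ε * ‖w‖ := by
  refine le_of_sq_le_sq ?_ (by positivity)
  rw [mul_pow, ← sum_sq_inner v, ← sum_sq_inner v, Finset.mul_sum]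
  refine Finset.sum_le_sum fun i _ => ?_
  rw [inner_eigenvector_apply hA (hv i), mul_pow]
  by_cases hi : i ∈ S
  · have : l i ^ 2 ≤ ε ^ 2 := by
      rw [← sq_abs]; have := hS i hi; gcongr
    gcongr
  · rw [hw i hi]; simp

theorem exists_eigenbasis {A : Op d} (hA : ∀ x y, inner ℝ (A x) y = inner ℝ x (A y)) :
    ∃ (v : OrthonormalBasis (Fin d) ℝ (Vec d)) (l : Fin d → ℝ), ∀ i, A (v i) = l i • v i := by
  have hs : (A : Vec d →ₗ[ℝ] Vec d).IsSymmetric := hA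
  have hn : Module.finrank ℝ (Vec d) = d := by simp
  exact ⟨hs.eigenvectorBasis hn, hs.eigenvalues hn, fun i => hs.apply_eigenvectorBasis hn i⟩

theorem degree_comp_C_mul_X_lt {Q : ℝ[X]} {t : ℕ} (hQ : Q.degree < t) (c : ℝ) :
    (Q.comp (C c * X)).degree < t := by
  rw [degree_lt_iff_coeff_zero] at hQ ⊢
  intro m hm
  rw [comp_C_mul_X_coeff, hQ m hm, zero_mul]

theorem degree_C_mul_lt {Q : ℝ[X]} {t : ℕ} (hQ : Q.degree < t) (c : ℝ) :
    (C c * Q).degree < t := by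
  rw [degree_lt_iff_coeff_zero] at hQ ⊢
  intro m hm
  rw [coeff_C_mul, hQ m hm, mul_zero]

set_option maxHeartbeats 800000 in
/-- The bound for the direction without any assumption on the rank of the perturbed matrix. -/
theorem norm_le_of_krylov {H E : Op d} {γ ε ν C : ℝ} {g p : Vec d} {t : ℕ}
    {K : Submodule ℝ (Vec d)} {X' : Op d}
    (hH : ∀ x y, inner ℝ (H x) y = inner ℝ x (H y))
    (hEs : ∀ x y, inner ℝ (E x) y = inner ℝ x (E y)) (hγ0 : 0 < γ)
    (hγ : ∀ p ∈ rangeOf H, γ * ‖p‖ ≤ ‖H p‖) (hE : ‖E‖ ≤ ε) (hε : 0 < ε) (hC : 1 ≤ C)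
    (hX : IsMoorePenroseInverse (H + E) X') (hXn : ‖X'‖ ≤ C / ε) (hν0 : 0 < ν) (hν1 : ν ≤ 1)
    (hg : ‖(rangeOf H)ᗮ.starProjection g‖ ^ 2 ≤
      (1 - ν) / ν * ‖(rangeOf H).starProjection g‖ ^ 2)
    (hν : 0 < 2 * ν - 1 - 4 * ε / γ) (hK : IsRangeInvariantKrylov (H + E) g t K)
    (hp : p ∈ residualMinimizers (H + E) g K) :
    ‖p‖ ≤ (1 / (γ - ε) + C * (2 / γ + Real.sqrt (1 - ν) / ε)) * ‖g‖ := by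
  have hA : ∀ x y, inner ℝ ((H + E) x) y = inner ℝ x ((H + E) y) := by
    intro x y
    simp only [_root_.add_apply, inner_add_left, inner_add_right, hH, hEs]
  obtain ⟨v, l, hv⟩ := exists_eigenbasis hA
  set A := H + E with hAdef
  set β := Real.sqrt (1 - ν) with hβdef
  have hβ0 : 0 ≤ β := Real.sqrt_nonneg _
  have hβsq : β ^ 2 = 1 - ν := Real.sq_sqrt (by linarith)
  set a := ε / γ with ha
  have ha0 : 0 < a := by positivity
  have h4a : 4 * ε / γ = 4 * a := by rw [ha]; ring
  rw [h4a] at hν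
  have hβ2 : β ^ 2 ≤ 1 / 2 - 2 * a := by rw [hβsq]; linarith
  have ha4 : a ≤ 1 / 4 := (reference_bounds ha0 hβ0 hβ2).1
  have hεa : ε = a * γ := by rw [ha]; field_simp
  have hεγ : ε ≤ γ / 4 := by rw [hεa]; nlinarith
  set h := ε / (γ - ε) with hh
  have hγε : 0 < γ - ε := by linarith
  have hha : h = a / (1 - a) := by
    have : 1 - a ≠ 0 := by linarith
    have h2 : γ - a * γ = γ * (1 - a) := by ring
    rw [hh, hεa, h2]; field_simp
  have hh0 : 0 ≤ h := by positivity
  set b : Fin d → ℝ := fun i => inner ℝ (v i) g with hb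
  set m : Fin d → ℝ := fun i => l i / ε with hm
  have hlm : ∀ i, l i = ε * m i := by intro i; simp only [hm]; field_simp
  have hmabs : ∀ i, |m i| = |l i| / ε := by
    intro i; simp only [hm]; rw [abs_div, abs_of_pos hε]
  have hv1 : ∀ i, ‖v i‖ = 1 := fun i => v.orthonormal.1 i
  have hV : ∀ i, 1 ≤ h * |m i| ∨ |m i| ≤ 1 := by
    intro i
    rw [hmabs]
    rcases eigenvalue_dichotomy hH hγ hE hε.le (v.orthonormal.ne_zero i) (hv i) with h1 | h1
    · right; rwa [div_le_one hε]
    · left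
      have : h * (|l i| / ε) = |l i| / (γ - ε) := by rw [hh]; field_simp
      rw [this, one_le_div hγε]; exact h1
  have hl : ∀ i, m i ≠ 0 → 1 ≤ C * |m i| := by
    intro i hi
    have hli : l i ≠ 0 := by rw [hlm]; exact mul_ne_zero hε.ne' hi
    have := one_le_mul_abs_eigenvalue hA hX hXn (hv1 i) (hv i) hli
    rw [hmabs]
    calc (1 : ℝ) ≤ _ := this
      _ = _ := by ring
  have hbG : ∑ i, b i ^ 2 ≤ ‖g‖ ^ 2 := (sum_sq_inner v g).le
  have hD : ∑ i, (if |m i| ≤ 1 then b i ^ 2 else 0) ≤ ((7 / 6 * a + β) * ‖g‖) ^ 2 := by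
    classical
    have h1 := sum_sq_inner_le_norm_starProjection v {i | |m i| ≤ 1} g
    refine le_trans (le_of_eq ?_) (h1.trans ?_)
    · refine Finset.sum_congr rfl fun i _ => ?_
      simp only [Set.mem_ofPred_eq, hb]
    · have h2 := norm_starProjection_gradient_le (W := coordSubspace v {i | |m i| ≤ 1}) hH hγ0 hγ
        hE hεγ (apply_starProjection_coordSubspace v _ hA hv)
        (fun w hw => norm_apply_le_of_mem_coordSubspace v hε.le hA hv
          (fun i hi => by
            have : |m i| ≤ 1 := hi
            rwa [hmabs, div_le_one hε] at this) hw) hν0 hν1 hg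
      gcongr
  have hnorm : ∀ c : Fin d → ℝ, (∀ i, c i ^ 2 = (ε * inner ℝ (v i) p) ^ 2) →
      ∑ i, c i ^ 2 ≤ (h + C * (2 * a + β)) ^ 2 * ‖g‖ ^ 2 →
      ‖p‖ ≤ (1 / (γ - ε) + C * (2 / γ + β / ε)) * ‖g‖ := by
    intro c hc hle
    rw [Finset.sum_congr rfl fun i _ => hc i] at hle
    simp only [mul_pow] at hle
    rw [← Finset.mul_sum, sum_sq_inner, ← mul_pow, ← mul_pow] at hle
    have hC0 : 0 ≤ C := by linarith
    have h1 := le_of_sq_le_sq hle (by positivity)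
    have h2 : h + C * (2 * a + β) = ε * (1 / (γ - ε) + C * (2 / γ + β / ε)) := by
      rw [hh, ha]; field_simp
    rw [h2, mul_assoc] at h1
    exact le_of_mul_le_mul_left h1 hε
  have hortho : ∀ q ∈ K, ∑ i, (l i * inner ℝ (v i) p + b i) * (l i * inner ℝ (v i) q) = 0 := by
    intro q hq
    have h1 := inner_residual_eq_zero hp hq
    rw [← v.sum_inner_mul_inner] at h1
    rw [← h1]
    refine Finset.sum_congr rfl fun i _ => ?_
    rw [real_inner_comm (v i) (A p + g), inner_add_right, inner_eigenvector_apply hA (hv i),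
      inner_eigenvector_apply hA (hv i)]
  rcases hK with rfl | ⟨hgr, rfl⟩
  · obtain ⟨Q, hQ, hQp⟩ := mem_krylov_iff.1 hp.1
    have hpi : ∀ i, inner ℝ (v i) p = Q.eval (l i) * (l i * b i) := by
      intro i
      rw [← hQp, inner_eigenvector_aeval hA (hv i), inner_eigenvector_apply hA (hv i)]
    -- Rescaled so that 1 − X²P at l/ε gives the residual coordinates and m·P(m)·b is −ε times a
    -- coordinate of p.
    set P : ℝ[X] := Polynomial.C (-ε ^ 2) * Q.comp (Polynomial.C ε * X) with hP
    have hPe : ∀ i, P.eval (m i) = -ε ^ 2 * Q.eval (l i) := by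
      intro i
      rw [hP, eval_mul, eval_C, eval_comp, eval_mul, eval_C, eval_X, ← hlm]
    refine hnorm (fun i => m i * P.eval (m i) * b i) (fun i => ?_)
      (sum_sq_le_of_krylov_shifted (t := t) ha0 hβ0 hβ2 hha hC (norm_nonneg g) hV hl hbG hD
        (degree_C_mul_lt (degree_comp_C_mul_X_lt hQ ε) _) fun q hq => ?_)
    · rw [hPe, hpi, hlm]; ring
    · have h1 := hortho _ (mem_krylov_iff.2
        ⟨q.comp (Polynomial.C ε⁻¹ * X), degree_comp_C_mul_X_lt hq _, rfl⟩)
      have h2 : ∀ i, (1 - X ^ 2 * P).eval (m i) * (m i ^ 2 * q.eval (m i)) * b i ^ 2 =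
          (ε ^ 2)⁻¹ * ((l i * inner ℝ (v i) p + b i) *
            (l i * inner ℝ (v i) ((aeval A (q.comp (Polynomial.C ε⁻¹ * X))) (A g)))) := by
        intro i
        rw [inner_eigenvector_aeval hA (hv i), inner_eigenvector_apply hA (hv i), hpi,
          eval_comp, eval_mul, eval_C, eval_X]
        have h3 : ε⁻¹ * l i = m i := by simp only [hm]; field_simp
        rw [h3, eval_sub, eval_one, eval_mul, eval_pow, eval_X, hPe, hlm i]
        simp only [hb]
        field_simp
        ring
      rw [Finset.sum_congr rfl fun i _ => h2 i, ← Finset.mul_sum, h1, mul_zero]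
  · obtain ⟨Q, hQ, hQp⟩ := mem_krylov_iff.1 hp.1
    have hpi : ∀ i, inner ℝ (v i) p = Q.eval (l i) * b i := by
      intro i
      rw [← hQp, inner_eigenvector_aeval hA (hv i)]
    set P : ℝ[X] := Polynomial.C (-ε) * Q.comp (Polynomial.C ε * X) with hP
    have hPe : ∀ i, P.eval (m i) = -ε * Q.eval (l i) := by
      intro i
      rw [hP, eval_mul, eval_C, eval_comp, eval_mul, eval_C, eval_X, ← hlm]
    refine hnorm (fun i => P.eval (m i) * b i) (fun i => ?_)
      (sum_sq_le_of_krylov (t := t) ha0 hβ0 hh0 (by linarith) hV hl hbG hD ?_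
        (degree_C_mul_lt (degree_comp_C_mul_X_lt hQ ε) _) fun q hq => ?_)
    · rw [hPe, hpi]; ring
    · intro i hi
      obtain ⟨y, hy⟩ := hgr
      have hy : A y = g := hy
      simp only [hb]
      rw [← hy, inner_eigenvector_apply hA (hv i), hlm, hi]; ring
    · have h1 := hortho _ (mem_krylov_iff.2
        ⟨q.comp (Polynomial.C ε⁻¹ * X), degree_comp_C_mul_X_lt hq _, rfl⟩)
      have h2 : ∀ i, (1 - X ^ 1 * P).eval (m i) * (m i * q.eval (m i)) * b i ^ 2 =
          ε⁻¹ * ((l i * inner ℝ (v i) p + b i) *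
            (l i * inner ℝ (v i) ((aeval A (q.comp (Polynomial.C ε⁻¹ * X))) g))) := by
        intro i
        rw [inner_eigenvector_aeval hA (hv i), hpi,
          eval_comp, eval_mul, eval_C, eval_X]
        have h3 : ε⁻¹ * l i = m i := by simp only [hm]; field_simp
        rw [h3, eval_sub, eval_one, eval_mul, eval_pow, eval_X, hPe, hlm i]
        simp only [hb]
        field_simp
        ring
      rw [Finset.sum_congr rfl fun i _ => h2 i, ← Finset.mul_sum, h1, mul_zero]

end Spectral

/-! ### Rank-preserving perturbations -/

section Acute

variable {d : ℕ}

/-- The bound for the direction when the perturbation preserves the rank. -/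
theorem norm_le_of_rank_eq {H E : Op d} {γ ε : ℝ} {g p : Vec d}
    (hH : ∀ x y, inner ℝ (H x) y = inner ℝ x (H y))
    (hEs : ∀ x y, inner ℝ (E x) y = inner ℝ x (E y))
    (hγ : ∀ p ∈ rangeOf H, γ * ‖p‖ ≤ ‖H p‖) (hE : ‖E‖ ≤ ε) (hε : 0 ≤ ε)
    (hεγ : 2 * ε < γ) (hrank : rankOf (H + E) = rankOf H) (hpr : p ∈ rangeOf (H + E))
    (hpg : ‖(H + E) p‖ ≤ ‖g‖) : ‖p‖ ≤ (γ - ε)⁻¹ * ‖g‖ := by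
  have hA : ∀ x y, inner ℝ ((H + E) x) y = inner ℝ x ((H + E) y) := by
    intro x y
    simp only [_root_.add_apply, inner_add_left, inner_add_right, hH, hEs]
  obtain ⟨v, l, hv⟩ := exists_eigenbasis hA
  have hdich : ∀ i, |l i| ≤ ε ∨ γ - ε ≤ |l i| := fun i =>
    eigenvalue_dichotomy hH hγ hE hε (v.orthonormal.ne_zero i) (hv i)
  set W := coordSubspace v {i | |l i| ≤ ε} with hW
  -- A vector of W has projection onto the range of H at most (2ε/γ)‖w‖ < ‖w‖ unless it is zero.
  -- With equal ranks, counting dimensions then forces W to be the kernel of H + E, so no small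
  -- eigenvalue is nonzero.
  have hdisj : Disjoint W (rangeOf H) := by
    rw [Submodule.disjoint_def]
    intro w hw hwU
    have h1 := norm_apply_le_of_mem_coordSubspace v hε hA hv (fun i hi => hi) hw
    have h2 := norm_starProjection_rangeOf_le hH hγ hE h1
    rw [(Submodule.starProjection_eq_self_iff).2 hwU] at h2
    rw [← norm_eq_zero]
    nlinarith [norm_nonneg w]
  have hker : LinearMap.ker (H + E).toLinearMap ≤ W := by
    intro x hx i hi
    have hx : (H + E) x = 0 := hx
    have h1 := inner_eigenvector_apply hA (hv i) x
    rw [hx, inner_zero_right] at h1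
    have hi : ¬ |l i| ≤ ε := hi
    have h2 : l i ≠ 0 := by
      intro h0; rw [h0, abs_zero] at hi; exact hi hε
    exact (mul_eq_zero.1 h1.symm).resolve_left h2
  have hle : Module.finrank ℝ W ≤ Module.finrank ℝ (LinearMap.ker (H + E).toLinearMap) := by
    have h1 := LinearMap.finrank_range_add_finrank_ker (H + E).toLinearMap
    have h2 := Submodule.finrank_add_finrank_le_of_disjoint hdisj
    have h3 : Module.finrank ℝ (LinearMap.range (H + E).toLinearMap) =
      Module.finrank ℝ (rangeOf H) := hrank
    omega
  have heq := Submodule.eq_of_le_of_finrank_le hker hle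
  have hzero : ∀ i, |l i| ≤ ε → l i = 0 := by
    intro i hi
    have h1 : v i ∈ W := basis_mem_coordSubspace v hi
    rw [← heq] at h1
    have h1 : (H + E) (v i) = 0 := h1
    rw [hv i] at h1
    exact (smul_eq_zero.1 h1).resolve_right (v.orthonormal.ne_zero i)
  obtain ⟨y, hy⟩ := hpr
  have hy : (H + E) y = p := hy
  have key : (γ - ε) * ‖p‖ ≤ ‖(H + E) p‖ := by
    refine le_of_sq_le_sq ?_ (norm_nonneg _)
    rw [mul_pow, ← sum_sq_inner v, ← sum_sq_inner v, Finset.mul_sum]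
    refine Finset.sum_le_sum fun i _ => ?_
    rw [inner_eigenvector_apply hA (hv i), mul_pow]
    rcases hdich i with h1 | h1
    · rw [← hy, inner_eigenvector_apply hA (hv i), hzero i h1]; simp
    · have : (γ - ε) ^ 2 ≤ l i ^ 2 := by
        rw [← sq_abs (l i)]
        have : 0 ≤ γ - ε := by linarith
        gcongr
      gcongr
  rw [le_inv_mul_iff₀ (by linarith)]
  exact key.trans hpg

end Acute

/-! ### Smoothness along the search direction -/

section Smoothness

variable {d : ℕ} {f : Vec d → ℝ}

/-- Symmetry of the second derivative needs only differentiability of the gradient, not continuity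
of the Hessian. -/
theorem hessian_symmetric (hf : TwiceDifferentiable f) (x u w : Vec d) :
    inner ℝ (hessian f x u) w = inner ℝ u (hessian f x w) := by
  have h1 : ∀ y, HasFDerivAt f (innerSL ℝ (gradient f y)) y := by
    intro y
    exact (hf.1 y).hasGradientAt.hasFDerivAt
  have h2 : HasFDerivAt (fun y => innerSL ℝ (gradient f y))
      ((innerSL ℝ).toContinuousLinearMap.comp (hessian f x)) x :=
    ((innerSL ℝ).toContinuousLinearMap.hasFDerivAt).comp x (hf.2 x).hasFDerivAt
  have h3 := second_derivative_symmetric h1 h2 u w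
  rw [real_inner_comm (hessian f x w) u]
  exact h3

theorem hasDerivAt_norm_gradient_sq (hf : TwiceDifferentiable f) (x p : Vec d) (a : ℝ) :
    HasDerivAt (fun a : ℝ => ‖gradient f (x + a • p)‖ ^ 2)
      (2 * inner ℝ (hessian f (x + a • p) (gradient f (x + a • p))) p) a := by
  have h1 : HasDerivAt (fun a : ℝ => x + a • p) p a := by
    have := ((hasDerivAt_id a).smul_const p).const_add x
    simpa using this
  have h2 : HasDerivAt (fun a : ℝ => gradient f (x + a • p)) (hessian f (x + a • p) p) a :=
    HasFDerivAt.comp_hasDerivAt (l := gradient f) a (hf.2 (x + a • p)).hasFDerivAt h1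
  have h3 := h2.norm_sq
  rw [hessian_symmetric hf]
  exact h3

/-- The difference of the two sides is monotone by the sign of its derivative, so the Hessian is
never integrated. Only x, not the trial point, must lie in the sublevel set. -/
theorem norm_gradient_sq_le {L : Vec d → ℝ} (hf : TwiceDifferentiable f) (hL : MorallySmooth f L)
    (x₀ x p : Vec d) (hx : ‖gradient f x‖ ≤ ‖gradient f x₀‖) {a : ℝ} (ha : 0 ≤ a) :
    ‖gradient f (x + a • p)‖ ^ 2 ≤ ‖gradient f x‖ ^ 2 +
      2 * a * inner ℝ (hessian f x (gradient f x)) p + L x₀ * a ^ 2 * ‖p‖ ^ 2 := by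
  set c := inner ℝ (hessian f x (gradient f x)) p with hc
  set ψ : ℝ → ℝ := fun a => ‖gradient f (x + a • p)‖ ^ 2 -
    (2 * a * c + L x₀ * a ^ 2 * ‖p‖ ^ 2) with hψ
  have hd : ∀ a, HasDerivAt ψ (2 * inner ℝ (hessian f (x + a • p) (gradient f (x + a • p))) p -
      (2 * c + L x₀ * (2 * a) * ‖p‖ ^ 2)) a := by
    intro a
    refine (hasDerivAt_norm_gradient_sq hf x p a).sub (HasDerivAt.add ?_ ?_)
    · have := ((hasDerivAt_id a).const_mul 2).mul_const c
      simpa using this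
    · have := ((hasDerivAt_pow 2 a).const_mul (L x₀)).mul_const (‖p‖ ^ 2)
      simpa using this
  have hanti : AntitoneOn ψ (Set.Ici 0) := by
    refine antitoneOn_of_deriv_nonpos (convex_Ici 0)
      (fun a _ => (hd a).continuousAt.continuousWithinAt)
      (fun a _ => (hd a).differentiableAt.differentiableWithinAt) fun a ha => ?_
    rw [interior_Ici] at ha
    have ha : 0 < a := ha
    rw [(hd a).deriv]
    have h1 := (hL x₀).2 x (x + a • p) hx
    rw [add_sub_cancel_left, norm_smul, Real.norm_eq_abs, abs_of_pos ha] at h1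
    have h2 := real_inner_le_norm (hessian f (x + a • p) (gradient f (x + a • p)) -
      hessian f x (gradient f x)) p
    rw [inner_sub_left, ← hc] at h2
    have h3 := mul_le_mul_of_nonneg_right h1 (norm_nonneg p)
    nlinarith
  have h1 := hanti (Set.mem_Ici.2 le_rfl) (Set.mem_Ici.2 ha) ha
  simp only [hψ, zero_smul, add_zero] at h1
  linarith

/-- The smoothness constant is bounded below in terms of the regularity constants. -/
theorem sq_mul_le_smoothness {L : Vec d → ℝ} {γ ν : ℝ} (hf : TwiceDifferentiable f)
    (hL : MorallySmooth f L) (hγ : PseudoInverseRegular f γ) (hν : NullSpaceProperty f ν)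
    {x₀ : Vec d} (hg : gradient f x₀ ≠ 0) : γ ^ 2 * ν ≤ L x₀ := by
  have hL0 := (hL x₀).1
  set g := gradient f x₀ with hgdef
  set q := hessian f x₀ g with hq
  -- The step 1/L along −Hg minimises the quadratic bound; its minimum ‖g‖² − ‖Hg‖²/L cannot be
  -- negative.
  have h1 := norm_gradient_sq_le hf hL x₀ x₀ (-q) le_rfl (a := (L x₀)⁻¹) (by positivity)
  rw [← hgdef, ← hq, inner_neg_right, real_inner_self_eq_norm_sq, norm_neg] at h1
  have h2 : L x₀ * (L x₀)⁻¹ ^ 2 * ‖q‖ ^ 2 = (L x₀)⁻¹ * ‖q‖ ^ 2 := by field_simp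
  rw [h2] at h1
  have h3 : 0 ≤ ‖gradient f (x₀ + (L x₀)⁻¹ • -q)‖ ^ 2 := sq_nonneg _
  have h4 : (L x₀)⁻¹ * ‖q‖ ^ 2 ≤ ‖g‖ ^ 2 := by linarith
  rw [inv_mul_le_iff₀ hL0] at h4
  have h5 := (norm_starProjection_orthogonal_le hν.1 hν.2.1 (hν.2.2 x₀)).2
  have h6 := hγ.2 x₀ _ ((rangeOf (hessian f x₀)).starProjection_apply_mem g)
  rw [apply_starProjection_rangeOf (hessian_symmetric hf x₀), ← hq] at h6
  have h7 : γ ^ 2 * ‖(rangeOf (hessian f x₀)).starProjection g‖ ^ 2 ≤ ‖q‖ ^ 2 := by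
    rw [← mul_pow]
    have := hγ.1
    gcongr
  have hgpos : 0 < ‖g‖ ^ 2 := by have := norm_pos_iff.2 hg; positivity
  have h8 : γ ^ 2 * ν * ‖g‖ ^ 2 ≤ L x₀ * ‖g‖ ^ 2 := by
    calc γ ^ 2 * ν * ‖g‖ ^ 2 = γ ^ 2 * (ν * ‖g‖ ^ 2) := by ring
      _ ≤ γ ^ 2 * ‖(rangeOf (hessian f x₀)).starProjection g‖ ^ 2 := by gcongr
      _ ≤ _ := by linarith
  exact le_of_mul_le_mul_right h8 hgpos

end Smoothness

/-! ### The line search -/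

/-- Every step a ≤ 2K/Q in [0, 1] is accepted. If 2K ≤ Q, the sufficient decrease at α ≥ 2K/Q is
enough; otherwise α = 1 and the quadratic bound itself is used, the Armijo decrease being too weak.
-/
theorem line_search_contraction {φ : ℝ → ℝ} {G D ρ c e Q α : ℝ} (hG : 0 ≤ G) (hρ : 0 < ρ)
    (hρ' : ρ < 1) (hc : 0 < c) (hcQ : c ≤ Q) (he : 0 ≤ e) (hD : c * G ≤ D)
    (hφ : ∀ a, 0 ≤ a → φ a ≤ G - 2 * a * D + 2 * a * (e * G) + a ^ 2 * (Q * G))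
    (hα : IsGreatest {a : ℝ | 0 ≤ a ∧ a ≤ 1 ∧ φ a ≤ G - 2 * ρ * a * D} α) :
    φ α ≤ (1 - max 0 (4 * ρ * c * ((1 - ρ) * c - e) / Q)) * G := by
  obtain ⟨⟨hα0, hα1, hα2⟩, hmax⟩ := hα
  have hQ : 0 < Q := hc.trans_le hcQ
  have hD0 : 0 ≤ D := le_trans (by positivity) hD
  set K := (1 - ρ) * c - e with hK
  have hbase : φ α ≤ G := by
    have : 0 ≤ 2 * ρ * α * D := by positivity
    linarith
  have hρD : (1 - ρ) * (c * G) ≤ (1 - ρ) * D := mul_le_mul_of_nonneg_left hD (by linarith)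
  -- a step length with `Q a ≤ 2 K` satisfies the line-search condition
  have harm : ∀ a, 0 ≤ a → a ≤ 1 → Q * a ≤ 2 * K → a ≤ α := by
    intro a ha ha1 hQa
    refine hmax ⟨ha, ha1, (hφ a ha).trans ?_⟩
    have h1 : Q * a * G ≤ 2 * K * G := mul_le_mul_of_nonneg_right hQa hG
    have h2 : 0 ≤ a * (2 * ((1 - ρ) * D) - 2 * (e * G) - Q * a * G) := by
      apply mul_nonneg ha
      have : 2 * K * G = 2 * ((1 - ρ) * (c * G)) - 2 * (e * G) := by rw [hK]; ring
      linarith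
    nlinarith
  have hmul : ∀ η, η ≤ 0 ∨ φ α ≤ (1 - η) * G → φ α ≤ (1 - max 0 η) * G := by
    intro η h
    rcases le_total η 0 with h0 | h0
    · rw [max_eq_left h0]; linarith
    · rcases h with h | h
      · rw [max_eq_left h]; linarith
      · rw [max_eq_right h0]; exact h
  apply hmul
  rcases le_or_gt K 0 with hK0 | hK0
  · left
    exact div_nonpos_of_nonpos_of_nonneg (mul_nonpos_of_nonneg_of_nonpos (by positivity) hK0) hQ.le
  right
  rcases le_or_gt (2 * K) Q with hKQ | hKQ
  · have h1 := harm (2 * K / Q) (by positivity) ((div_le_one hQ).2 hKQ)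
      (by rw [mul_div_cancel₀ _ hQ.ne'])
    have h2 : 2 * ρ * (2 * K / Q) * (c * G) ≤ 2 * ρ * α * D := by gcongr
    have h3 : 4 * ρ * c * K / Q * G = 2 * ρ * (2 * K / Q) * (c * G) := by ring
    linarith
  · have h1 : α = 1 := le_antisymm hα1 (harm 1 zero_le_one le_rfl (by linarith))
    have h2 := hφ 1 zero_le_one
    rw [h1]
    have h3 : 4 * ρ * c * K / Q ≤ 2 * c - 2 * e - Q := by
      rw [div_le_iff₀ hQ]
      -- The claim is (2K − Q)(Q − 2ρc) ≥ 0. For ρ > 1/2 the case is void, as 2K ≤ 2(1−ρ)c < c ≤ Q.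
      have h4 : 0 ≤ Q - 2 * ρ * c := by
        rcases le_or_gt ρ (1 / 2) with h5 | h5
        · nlinarith
        · nlinarith
      nlinarith [mul_nonneg (sub_nonneg.2 hKQ.le) h4]
    nlinarith [mul_le_mul_of_nonneg_right h3 hG]

theorem contraction_factor_le_one {ρ c e Q : ℝ} (hρ : 0 < ρ) (hc : 0 < c) (hc1 : c ≤ 1)
    (hcQ : c ≤ Q) (he : 0 ≤ e) : max 0 (4 * ρ * c * ((1 - ρ) * c - e) / Q) ≤ 1 := by
  refine max_le zero_le_one ?_
  rw [div_le_one (hc.trans_le hcQ)]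
  have h1 : 4 * ρ * (1 - ρ) ≤ 1 := by nlinarith [sq_nonneg (2 * ρ - 1)]
  have h2 : 4 * ρ * (1 - ρ) * (c * c) ≤ 1 * (c * c) := by gcongr
  have h3 : 0 ≤ 4 * ρ * c * e := by positivity
  nlinarith

theorem eta_eq (ρ θ ε γt L₀ : ℝ) :
    eta ρ θ ε γt L₀ =
      max 0 (4 * ρ * (1 - θ) * ((1 - ρ) * (1 - θ) - ε / γt) / (L₀ / γt ^ 2)) := by
  unfold eta
  congr 1
  rw [div_div_eq_mul_div]
  ring

/-! ### The constants and the direction in each regime -/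

/-- Outside the acute regime, positivity of ν̃ already gives ε < γ/4, which is stronger than the
condition ε < γ/2 stated for ν = 1. -/
theorem regime_constants {R : Regime} {γ ν ε C : ℝ} (hγ : 0 < γ) (hν1 : ν ≤ 1)
    (hε : 0 < ε) (hC : 1 ≤ C) (hR : R.Condition γ ν ε) (hνt : 0 < R.nuTilde γ ν ε) :
    2 * ε < γ ∧ 0 < R.gammaTilde γ ν ε C ∧ R.gammaTilde γ ν ε C ≤ γ ∧ R.nuTilde γ ν ε ≤ ν := by
  have hq : 0 < ε / γ := by positivity
  have hgen : 0 < 2 * ν - 1 - 4 * ε / γ → 2 * ε < γ ∧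
      0 < (1 / (γ - ε) + C * (2 / γ + Real.sqrt (1 - ν) / ε))⁻¹ ∧
      (1 / (γ - ε) + C * (2 / γ + Real.sqrt (1 - ν) / ε))⁻¹ ≤ γ ∧
      2 * ν - 1 - 4 * ε / γ ≤ ν := by
    intro h
    have h1 : 4 * ε / γ = 4 * (ε / γ) := by ring
    have h2 : ε / γ < 1 / 4 := by linarith
    rw [div_lt_iff₀ hγ] at h2
    have h3 : 0 < γ - ε := by linarith
    have h4 : 0 ≤ C * (2 / γ + Real.sqrt (1 - ν) / ε) := by positivity
    refine ⟨by linarith, by positivity, ?_, by linarith⟩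
    rw [inv_le_comm₀ (by positivity) hγ]
    have h5 : γ⁻¹ ≤ 1 / (γ - ε) := by
      rw [one_div]
      exact inv_anti₀ h3 (by linarith)
    linarith
  cases R with
  | general => exact hgen hνt
  | fullRange => exact hgen hνt
  | acute =>
    have h1 : ε < γ * ν / 2 := hR.2.2
    have h2 : γ * ν ≤ γ * 1 := by gcongr
    refine ⟨by linarith, ?_, ?_, ?_⟩
    · show 0 < γ - ε
      linarith
    · show γ - ε ≤ γ
      linarith
    · show ν - 2 * ε / γ ≤ ν
      have : 0 ≤ 2 * ε / γ := by positivity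
      linarith

theorem norm_direction_le {d : ℕ} {f : Vec d → ℝ} {R : Regime} {γ ν ε C θ : ℝ} {At : Op d}
    {x p : Vec d} (hγ : PseudoInverseRegular f γ) (hν : NullSpaceProperty f ν) (hε : 0 < ε)
    (hC : 1 ≤ C) (hR : R.Condition γ ν ε) (hνt : 0 < R.nuTilde γ ν ε)
    (hsym : ∀ u w, inner ℝ (hessian f x u) w = inner ℝ u (hessian f x w))
    (hpert : IsPerturbation (hessian f x) At ε C)
    (hacute : R = Regime.acute → rankOf At = rankOf (hessian f x))
    (hp : IsInexactDirection At (gradient f x) θ p) :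
    ‖p‖ ≤ (R.gammaTilde γ ν ε C)⁻¹ * ‖gradient f x‖ := by
  obtain ⟨⟨E, hEs, rfl, hE⟩, X, hX, hXn⟩ := hpert
  obtain ⟨⟨t, -, -, K, hK, hpK, -⟩, hpr, -⟩ := hp
  have hEs' : ∀ u w, inner ℝ (E u) w = inner ℝ u (E w) := hEs.isSymmetric
  have hgen : 0 < 2 * ν - 1 - 4 * ε / γ →
      ‖p‖ ≤ ((1 / (γ - ε) + C * (2 / γ + Real.sqrt (1 - ν) / ε))⁻¹)⁻¹ * ‖gradient f x‖ := by
    intro h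
    rw [inv_inv]
    exact norm_le_of_krylov hsym hEs' hγ.1 (hγ.2 x) hE hε hC hX hXn hν.1 hν.2.1 (hν.2.2 x) h hK hpK
  cases R with
  | general => exact hgen hνt
  | fullRange => exact hgen hνt
  | acute =>
    exact norm_le_of_rank_eq hsym hEs' (hγ.2 x) hE hε.le
      (regime_constants hγ.1 hν.2.1 hε hC hR hνt).1 (hacute rfl) hpr
      (norm_apply_le_of_mem_residualMinimizers hpK)

end NewtonMR

/-! ### Assembly of the contraction estimate -/

theorem mainTheorem3 (d : ℕ) (f : NewtonMR.Vec d → ℝ) (L : NewtonMR.Vec d → ℝ)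
    (γ ν ε C ρ τ θ : ℝ) (R : NewtonMR.Regime)
    (Ht : ℕ → NewtonMR.Op d) (x p : ℕ → NewtonMR.Vec d) (α : ℕ → ℝ)
    (hf : NewtonMR.TwiceDifferentiable f)
    (hL : NewtonMR.MorallySmooth f L)
    (hγ : NewtonMR.PseudoInverseRegular f γ)
    (hν : NewtonMR.NullSpaceProperty f ν)
    (hε : 0 < ε) (hC : 1 ≤ C)
    (hρ : 0 < ρ) (hρ' : ρ < 1) (hτ : 0 < τ) (hτ' : τ < 1)
    (hpert : ∀ k : ℕ, NewtonMR.Performed f τ x k →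
      NewtonMR.IsPerturbation (NewtonMR.hessian f (x k)) (Ht k) ε C)
    (hR : R.Condition γ ν ε)
    (hacute : R = NewtonMR.Regime.acute → ∀ k : ℕ, NewtonMR.Performed f τ x k →
      NewtonMR.rankOf (Ht k) = NewtonMR.rankOf (NewtonMR.hessian f (x k)))
    (hθ : 1 - R.nuTilde γ ν ε ≤ θ) (hθ' : θ < 1)
    (hrun : NewtonMR.IsInexactRun f τ ρ θ Ht x p α) :
    (gradient f (x 0) ≠ 0 →
      0 ≤ NewtonMR.eta ρ θ ε (R.gammaTilde γ ν ε C) (L (x 0)) ∧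
        NewtonMR.eta ρ θ ε (R.gammaTilde γ ν ε C) (L (x 0)) ≤ 1) ∧
    ∀ k : ℕ, NewtonMR.Performed f τ x k →
      ‖gradient f (x (k + 1))‖ ^ 2 ≤
        (1 - NewtonMR.eta ρ θ ε (R.gammaTilde γ ν ε C) (L (x 0))) *
          ‖gradient f (x k)‖ ^ 2 := by
  have hν1 := hν.2.1
  have hγ0 := hγ.1
  have hc : 0 < 1 - θ := by linarith
  have hνt : 1 - θ ≤ R.nuTilde γ ν ε := by linarith
  obtain ⟨-, hγt, hγtγ, hcν⟩ := NewtonMR.regime_constants hγ0 hν1 hε hC hR (hc.trans_le hνt)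
  have hsym := fun y => NewtonMR.hessian_symmetric hf y
  set γt := R.gammaTilde γ ν ε C with hγtdef
  have hL0 := (hL (x 0)).1
  -- Combines 1 − θ ≤ ν̃ ≤ ν and γ̃ ≤ γ with the lower bound γ²ν ≤ L(x₀).
  have hQ : gradient f (x 0) ≠ 0 → 1 - θ ≤ L (x 0) / γt ^ 2 := by
    intro hg
    rw [le_div_iff₀ (by positivity)]
    refine le_trans ?_ (NewtonMR.sq_mul_le_smoothness hf hL hγ hν hg)
    rw [mul_comm]
    have : 1 - θ ≤ ν := by linarith
    gcongr
  refine ⟨fun hg => ⟨le_max_left _ _, ?_⟩, ?_⟩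
  · rw [NewtonMR.eta_eq]
    exact NewtonMR.contraction_factor_le_one hρ hc (by linarith) (hQ hg) (by positivity)
  have hstep : ∀ k, NewtonMR.Performed f τ x k →
      ‖gradient f (x k)‖ ≤ ‖gradient f (x 0)‖ →
      ‖gradient f (x (k + 1))‖ ^ 2 ≤
        (1 - NewtonMR.eta ρ θ ε γt (L (x 0))) * ‖gradient f (x k)‖ ^ 2 := by
    intro k hk hle
    obtain ⟨hdir, hα, hx⟩ := hrun k hk
    have hp := NewtonMR.norm_direction_le hγ hν hε hC hR (hc.trans_le hνt) (hsym (x k))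
      (hpert k hk) (fun h => hacute h k hk) hdir
    obtain ⟨⟨E, hEs, hHt, hE⟩, -⟩ := hpert k hk
    set g := gradient f (x k) with hg
    have hg0 : gradient f (x 0) ≠ 0 := by
      intro h0
      have := hk 0 (Nat.zero_le k)
      rw [h0, norm_zero] at this
      linarith
    rw [NewtonMR.eta_eq, hx]
    refine NewtonMR.line_search_contraction
      (φ := fun a => ‖gradient f (x k + a • p k)‖ ^ 2)
      (D := -inner ℝ (p k) (Ht k g)) (e := ε / γt) (sq_nonneg _) hρ hρ' hc (hQ hg0)
      (by positivity) ?_ (fun a ha => ?_) ?_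
    · have := hdir.2.2
      linarith
    · refine (NewtonMR.norm_gradient_sq_le hf hL (x 0) (x k) (p k) hle ha).trans ?_
      rw [← hg]
      have h1 : inner ℝ (NewtonMR.hessian f (x k) g) (p k) =
          inner ℝ (p k) (Ht k g) - inner ℝ (p k) (E g) := by
        rw [hHt, real_inner_comm, _root_.add_apply, inner_add_right]; ring
      have h2 : -inner ℝ (p k) (E g) ≤ ε / γt * ‖g‖ ^ 2 := by
        have h3 := abs_real_inner_le_norm (p k) (E g)
        have h4 : ‖E g‖ ≤ ε * ‖g‖ := (E.le_opNorm g).trans (by gcongr)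
        calc -inner ℝ (p k) (E g) ≤ |inner ℝ (p k) (E g)| := neg_le_abs _
          _ ≤ ‖p k‖ * ‖E g‖ := h3
          _ ≤ (γt⁻¹ * ‖g‖) * (ε * ‖g‖) := by gcongr
          _ = _ := by ring
      have h5 : L (x 0) * ‖p k‖ ^ 2 ≤ L (x 0) / γt ^ 2 * ‖g‖ ^ 2 := by
        calc L (x 0) * ‖p k‖ ^ 2 ≤ L (x 0) * (γt⁻¹ * ‖g‖) ^ 2 := by gcongr
          _ = _ := by ring
      rw [h1]
      have h6 := mul_le_mul_of_nonneg_left h2 (by positivity : 0 ≤ 2 * a)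
      have h7 := mul_le_mul_of_nonneg_left h5 (sq_nonneg a)
      linarith
    · convert hα using 4
      unfold NewtonMR.Armijo
      rw [← hg]
      constructor
      · rintro ⟨h1, h⟩; exact ⟨h1, by linarith⟩
      · rintro ⟨h1, h⟩; exact ⟨h1, by linarith⟩
  -- The gradient norms must stay below the initial one for the single constant L(x₀) to apply at
  -- every iterate.
  have hmono : ∀ k, NewtonMR.Performed f τ x k → ‖gradient f (x k)‖ ≤ ‖gradient f (x 0)‖ := by
    intro k
    induction k with
    | zero => exact fun _ => le_rfl
    | succ k ih =>
      intro hk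
      have hk' : NewtonMR.Performed f τ x k := fun j hj => hk j (by omega)
      refine le_trans ?_ (ih hk')
      refine le_of_sq_le_sq ((hstep k hk' (ih hk')).trans ?_) (norm_nonneg _)
      have : 0 ≤ NewtonMR.eta ρ θ ε γt (L (x 0)) := le_max_left _ _
      nlinarith [sq_nonneg ‖gradient f (x k)‖]
  exact fun k hk => hstep k hk (hmono k hk)
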